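/- A $2$-copula is a function $C:[0,1]^2\to[0,1]$ with $C(u,0)=C(0,v)=0$, $C(u,1)=u$, $C(1,v)=v$ and $C(b_1,b_2)-C(a_1,b_2)-C(b_1,a_2)+C(a_1,a_2)\ge 0$ whenever $a_1\le b_1$, $a_2\le b_2$. Let $\mu_C$ be the Borel probability measure on $[0,1]^2$ with $\mu_C([0,u]\times[0,v])=C(u,v)$ for all $u,v$; the support of $C$ is the (topological) support of $\mu_C$. A subset $M$ of a real vector space $X$ is maximal convex lineable if there is an infinite linearly independent set $A\subset X$ with $\mathrm{conv}(A)\subset M$ and $\mathrm{card}(A)=\mathrm{card}(X)$. A transformation matrix is a nonnegative square matrix $T=(t_{ij})$ with entries of sum $1$ and without zero row or column. Reading $T$ as a picture of the unit square (columns from left to right, rows from top to bottom), divide $[0,1]^2$ into cells $R_{ij}$ such that the $j$-th column of cells has as width the sum of the $j$-th column of $T$, and the $i$-th row of cells has as height the sum of the $i$-th row of $T$. Let $\varphi_{ij}$ be the increasing coordinatewise affine map of $[0,1]^2$ onto $R_{ij}$. For a copula $C$, $T(C)$ is the copula with measure $\sum_{i,j}t_{ij}\,(\varphi_{ij})_*\mu_C$;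 $C$ is invariant for $T$ if $T(C)=C$. Let $r\in(0,1/2)$ and $s\in(1,2)$ satisfy $4r^s+(1-2r)^s=1$, and let $S_{1,s}$ be the set of all $2$-copulas whose support has Hausdorff dimension $s$, as a subset of the space $X$ of continuous real functions on $[0,1]^2$. **Theorem.** $S_{1,s}$ is maximal convex lineable. More precisely, for $0<a<r$ let $$T_{r,a}=\begin{bmatrix} r-a&0&a\\ 0&1-2r&0\\ a&0&r-a\end{bmatrix}.$$ Then $T_{r,a}$ is a transformation matrix and has exactly one invariant copula $C_{r,a}$; the measures $\mu_{C_{r,a}}$, $0<a<r$, are pairwise mutually singular; they all have the same support $K$, a nonempty compact set of Hausdorff dimension $s$ that is the union of the sets $\varphi_{ij}(K)$ over all $(i,j)$ for which the entry of $T_{r,a}$ is not zero; and $A=\{C_{r,a}:0<a<r\}$ is an infinite linearly independent set with $\mathrm{conv}(A)\subset S_{1,s}$ and $\mathrm{card}(A)=\mathrm{card}(X)=\mathfrak c$. -/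

import Mathlib

open scoped unitInterval

/-- A (bivariate) copula: a function on the unit square with values in `[0,1]`, grounded, with
uniform margins, and with nonnegative volume on every box `[a₁,b₁] × [a₂,b₂]`. -/
structure IsCopula (C : I × I → ℝ) : Prop where
  mem_Icc : ∀ p, C p ∈ Set.Icc (0 : ℝ) 1
  zero_left : ∀ v, C (0, v) = 0
  zero_right : ∀ u, C (u, 0) = 0
  one_left : ∀ v, C (1, v) = v
  one_right : ∀ u, C (u, 1) = u
  volume_nonneg : ∀ a₁ b₁ a₂ b₂ : I, a₁ ≤ b₁ → a₂ ≤ b₂ →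
    0 ≤ C (b₁, b₂) - C (a₁, b₂) - C (b₁, a₂) + C (a₁, a₂)

/-- `μ` is the Borel probability measure on the unit square determined by
`C (u, v) = μ ([0,u] × [0,v])`. It is unique by `IsCopulaMeasure.unique` below. -/
structure IsCopulaMeasure (C : I × I → ℝ) (μ : MeasureTheory.Measure (I × I)) : Prop where
  isProbabilityMeasure : MeasureTheory.IsProbabilityMeasure μ
  measure_box : ∀ u v : I, μ (Set.Icc 0 u ×ˢ Set.Icc 0 v) = ENNReal.ofReal (C (u, v))

theorem IsCopulaMeasure.unique {C : I × I → ℝ} {μ ν : MeasureTheory.Measure (I × I)}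
    (hμ : IsCopulaMeasure C μ) (hν : IsCopulaMeasure C ν) : μ = ν := by
  have := hμ.isProbabilityMeasure
  have := hν.isProbabilityMeasure
  have hgen : (inferInstance : MeasurableSpace (I × I)) =
      MeasurableSpace.generateFrom
        (Set.image2 (· ×ˢ ·) (Set.range (Set.Iic : I → Set I)) (Set.range (Set.Iic : I → Set I))) := by
    have h1 : MeasurableSpace.generateFrom (Set.range (Set.Iic : I → Set I))
        = (inferInstance : MeasurableSpace I) :=
      ((BorelSpace.measurable_eq (α := I)).trans (borel_eq_generateFrom_Iic I)).symm
    have hs : IsCountablySpanning (Set.range (Set.Iic : I → Set I)) :=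
      ⟨fun _ => Set.univ, fun _ => ⟨1, Set.eq_univ_of_forall fun x => x.2.2⟩,
        Set.iUnion_const _⟩
    exact (generateFrom_eq_prod h1 h1 hs hs).symm
  have hpi : IsPiSystem (Set.image2 (· ×ˢ ·) (Set.range (Set.Iic : I → Set I))
      (Set.range (Set.Iic : I → Set I))) := by
    have h : IsPiSystem (Set.range (Set.Iic : I → Set I)) := isPiSystem_Iic
    exact h.prod h
  refine MeasureTheory.ext_of_generate_finite _ hgen hpi ?_ (by simp)
  rintro _ ⟨_, ⟨u, rfl⟩, _, ⟨v, rfl⟩, rfl⟩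
  have hI : ∀ w : I, Set.Iic w = Set.Icc 0 w := fun w =>
    Set.ext fun (x : I) => ⟨fun h => ⟨x.2.1, h⟩, fun h => h.2⟩
  simp only [hI]
  rw [hμ.measure_box, hν.measure_box]

/-- The set of bivariate copulas, inside the real vector space of continuous functions on the unit
square, whose support (the topological support of the induced measure) has Hausdorff dimension
`s`. The product metric on the square is bi-Lipschitz equivalent to the Euclidean metric, so that
both give the same Hausdorff dimension. -/
def copulasWithSupportDim (s : ℝ) : Set C(I × I, ℝ) :=
  {C | IsCopula C ∧ ∃ μ, IsCopulaMeasure C μ ∧ dimH μ.support = ENNReal.ofReal s}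

section Lineability

variable {X : Type*} [AddCommGroup X] [Module ℝ X]

/-- `A` is an infinite linearly independent set with convex hull contained in `M`. -/
def WitnessesConvexLineable (A M : Set X) : Prop :=
  A.Infinite ∧ LinearIndepOn ℝ id A ∧ convexHull ℝ A ⊆ M

/-- `M` is convex lineable, with a witness of the same cardinality as the whole space `X`. -/
def MaximalConvexLineable (M : Set X) : Prop :=
  ∃ A : Set X, WitnessesConvexLineable A M ∧ Cardinal.mk A = Cardinal.mk X

end Lineability

section Transformation

variable {n : ℕ}

/-- A nonnegative square matrix with entries of sum `1` and with no zero row or column. -/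
structure IsTransformationMatrix (T : Matrix (Fin n) (Fin n) ℝ) : Prop where
  nonneg : ∀ i j, 0 ≤ T i j
  sum_eq_one : ∑ i, ∑ j, T i j = 1
  row_ne_zero : ∀ i, ∃ j, T i j ≠ 0
  col_ne_zero : ∀ j, ∃ i, T i j ≠ 0

/- The matrix is read as a picture of the unit square: the columns go from left to right and the
rows from top to bottom. The entry `T i j` belongs to the cell
`[colStart T j, colStart T j + colWidth T j] × [rowStart T i, rowStart T i + rowHeight T i]`. -/

/-- The width of the `j`-th column of cells: the sum of the `j`-th column. -/
def colWidth (T : Matrix (Fin n) (Fin n) ℝ) (j : Fin n) : ℝ := ∑ i, T i j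

/-- The height of the `i`-th row of cells: the sum of the `i`-th row. -/
def rowHeight (T : Matrix (Fin n) (Fin n) ℝ) (i : Fin n) : ℝ := ∑ j, T i j

/-- The left end of the `j`-th column of cells. -/
def colStart (T : Matrix (Fin n) (Fin n) ℝ) (j : Fin n) : ℝ :=
  ∑ k ∈ Finset.Iio j, colWidth T k

/-- The lower end of the `i`-th row of cells; the rows below it are those of larger index. -/
def rowStart (T : Matrix (Fin n) (Fin n) ℝ) (i : Fin n) : ℝ :=
  ∑ k ∈ Finset.Ioi i, rowHeight T k

/-- Projection of the real line onto the unit interval. -/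
noncomputable def clampUnit (x : ℝ) : I := Set.projIcc (0 : ℝ) 1 zero_le_one x

/-- The affine map of the unit square onto the cell of the entry `T i j`. For a transformation
matrix the cell lies in the unit square, so that `clampUnit` does nothing here. -/
noncomputable def cellMap (T : Matrix (Fin n) (Fin n) ℝ) (i j : Fin n) (p : I × I) : I × I :=
  (clampUnit (colStart T j + colWidth T j * p.1), clampUnit (rowStart T i + rowHeight T i * p.2))

/-- The action `C ↦ T(C)` of a transformation matrix on copulas: in each cell, a copy of the mass
of `C` is placed, rescaled affinely to the cell and multiplied by the entry `T i j`. The summand of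
`(i, j)` is the mass that this copy gives to `[0,u] × [0,v]`: the inverse of the affine map onto the
cell sends `(u, v)` to the point below, and coordinates beyond the cell are cut off to `0` or `1`. -/
noncomputable def transformCopula (T : Matrix (Fin n) (Fin n) ℝ) (C : I × I → ℝ) : I × I → ℝ :=
  fun p => ∑ i, ∑ j, T i j *
    C (clampUnit ((p.1 - colStart T j) / colWidth T j),
      clampUnit ((p.2 - rowStart T i) / rowHeight T i))

/-- `C` is a copula with `T(C) = C`. -/
def IsInvariantCopula (T : Matrix (Fin n) (Fin n) ℝ) (C : I × I → ℝ) : Prop :=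
  IsCopula C ∧ transformCopula T C = C

end Transformation

/-- The transformation matrix `T_{r,a}`. -/
def transMatrix (r a : ℝ) : Matrix (Fin 3) (Fin 3) ℝ :=
  !![r - a, 0, a;
     0, 1 - 2 * r, 0;
     a, 0, r - a]

/-!
The nonzero entries of `transMatrix r a` sit at the corners and the center of the picture, and the
cells there are squares of side `r` and `1 - 2 * r`, whatever `a` is. So all these matrices belong
to one family of five similarities of the unit square, `squareMap r`, and `a` enters only
through the weights. Let `π` be the coding map of the family (`IsCodingMap`,
`exists_isCodingMap`), from sequences of symbols to the square, and `K` its range, the attractor.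
The measure of the copula `C a` is the image under `π` of the Bernoulli measure with the entries of
`transMatrix r a` as weights.

* This measure is self-similar (`IsCodingMap.map_bernoulliMeasure`). Its margins are therefore
  self-similar measures on the interval, and Lebesgue measure is the only one of these
  (`eq_volume_of_selfSimilar`); hence the distribution function is a copula, and self-similarity
  says that it is invariant (`transformCopula_squareCdf`). Uniqueness holds because the action on
  copulas contracts the supremum distance (`IsInvariantCopula.eq`).
* All weights are positive, so that the support is `K`
  (`IsCodingMap.support_map_bernoulliMeasure`).
* By the law of large numbers, Bernoulli measures with different weights are mutually singular.
  Cells overlap only in grid lines, which are null because the margins are uniform, so `π` is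
  injective on a set of full measure and the singularity persists in the square
  (`IsCodingMap.mutuallySingular_map`).
* The equation for `s` says that `s` is the similarity dimension of the family. Covering `K` by the
  cells of the words of length `n` gives `dimH K ≤ s` (`dimH_range_le_of_isCodingMap`). For the
  other inequality, the mass distribution principle is applied to the self-similar measure with the
  weights `ρ ^ s`, for `ρ` the ratios of the similarities. In place of counting cells of comparable
  size, the mass of a set is compared with the area of its thickening, by induction on the scale
  (`measure_le_measure_thickening`).
* Mutual singularity yields linear independence (`linearIndependent_of_mutuallySingular`), and a
  convex combination of copulas with support `K` has support `K`
  (`convex_copulas_with_support`). The set of the copulas `C a` has the cardinality of the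
  continuum, as has the space of continuous functions on the square.
-/

open MeasureTheory Set Filter Topology
open scoped ENNReal NNReal unitInterval

/-! ### Bernoulli measures on sequences -/

section Bernoulli

variable {ι : Type*}

/-- The sequence `i, ω 0, ω 1, …`. -/
def consSeq (i : ι) (ω : ℕ → ι) : ℕ → ι
  | 0 => i
  | n + 1 => ω n

theorem consSeq_head_tail (ω : ℕ → ι) : consSeq (ω 0) (fun n => ω (n + 1)) = ω := by
  funext n
  cases n <;> rfl

theorem measurable_consSeq [MeasurableSpace ι] (i : ι) : Measurable (consSeq i) := by
  refine measurable_pi_lambda _ fun n => ?_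
  cases n with
  | zero => exact measurable_const
  | succ n => exact measurable_pi_apply n

variable [Fintype ι] [MeasurableSpace ι] [DiscreteMeasurableSpace ι]

/-- The measure on the finite set `ι` with mass `p i` at `i`. -/
noncomputable def weightMeasure (p : ι → ℝ≥0∞) : Measure ι := ∑ i, p i • Measure.dirac i

theorem weightMeasure_apply (p : ι → ℝ≥0∞) (s : Set ι) :
    weightMeasure p s = ∑ i, p i * s.indicator 1 i := by
  simp [weightMeasure]

theorem isProbabilityMeasure_weightMeasure {p : ι → ℝ≥0∞} (hp : ∑ i, p i = 1) :
    IsProbabilityMeasure (weightMeasure p) :=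
  ⟨by simp [weightMeasure_apply, hp]⟩

/-- The law of a sequence of independent symbols, each distributed according to `p`. -/
noncomputable def bernoulliMeasure (p : ι → ℝ≥0∞) : Measure (ℕ → ι) :=
  Measure.infinitePi fun _ => weightMeasure p

theorem isProbabilityMeasure_bernoulliMeasure {p : ι → ℝ≥0∞} (hp : ∑ i, p i = 1) :
    IsProbabilityMeasure (bernoulliMeasure p) := by
  have := isProbabilityMeasure_weightMeasure hp
  unfold bernoulliMeasure
  infer_instance

/-- A random sequence remains Bernoulli when an independent random symbol is put in front. -/
theorem sum_map_consSeq_bernoulliMeasure {p : ι → ℝ≥0∞} (hp : ∑ i, p i = 1) :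
    ∑ i, p i • (bernoulliMeasure p).map (consSeq i) = bernoulliMeasure p := by
  classical
  have := isProbabilityMeasure_weightMeasure hp
  refine Measure.eq_infinitePi _ fun s t ht => ?_
  -- boxes constraining an initial segment of the coordinates suffice
  obtain ⟨n, hn⟩ : ∃ n, s ⊆ Finset.range (n + 1) :=
    ⟨s.sup id, fun k hk => Finset.mem_range.2 (Nat.lt_succ_of_le (Finset.le_sup (f := id) hk))⟩
  set t' : ℕ → Set ι := fun j => if j ∈ s then t j else univ with ht'
  have h1 : Set.pi (s : Set ℕ) t = Set.pi (Finset.range (n + 1) : Set ℕ) t' := by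
    ext ω
    simp only [Set.mem_pi, Finset.mem_coe, ht']
    constructor
    · intro h j _
      by_cases hj : j ∈ s
      · simpa [hj] using h j hj
      · simp [hj]
    · intro h j hj
      simpa [hj] using h j (hn hj)
  have h2 : ∏ j ∈ s, weightMeasure p (t j)
      = ∏ j ∈ Finset.range (n + 1), weightMeasure p (t' j) := by
    rw [← Finset.prod_subset hn (f := fun j => weightMeasure p (t' j))]
    · exact Finset.prod_congr rfl fun j hj => by simp [ht', hj]
    · intro j _ hj
      simp [ht', hj]
  have h3 : ∀ i, ((bernoulliMeasure p).map (consSeq i)) (Set.pi (Finset.range (n + 1) : Set ℕ) t')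
      = (t' 0).indicator 1 i * ∏ j ∈ Finset.range n, weightMeasure p (t' (j + 1)) := by
    intro i
    rw [Measure.map_apply (measurable_consSeq i)
      (MeasurableSet.pi (Finset.countable_toSet _) fun _ _ => MeasurableSet.of_discrete)]
    by_cases hi : i ∈ t' 0
    · have : consSeq i ⁻¹' Set.pi (Finset.range (n + 1) : Set ℕ) t'
          = Set.pi (Finset.range n : Set ℕ) fun j => t' (j + 1) := by
        ext ω
        simp only [Set.mem_preimage, Set.mem_pi, Finset.mem_coe, Finset.mem_range]
        constructor
        · intro h j hj
          exact h (j + 1) (by omega)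
        · rintro h (_ | j) hj
          · exact hi
          · exact h j (by omega)
      rw [this, bernoulliMeasure, Measure.infinitePi_pi _ fun _ _ => MeasurableSet.of_discrete]
      simp [hi]
    · have : consSeq i ⁻¹' Set.pi (Finset.range (n + 1) : Set ℕ) t' = ∅ := by
        ext ω
        simp only [Set.mem_preimage, Set.mem_pi, Finset.mem_coe, Finset.mem_range,
          Set.mem_empty_iff_false, iff_false]
        exact fun h => hi (h 0 (by omega))
      rw [this]
      simp [hi]
  rw [h1, h2, Finset.prod_range_succ', weightMeasure_apply p (t' 0)]
  simp only [Measure.coe_finsetSum, Finset.sum_apply, Measure.smul_apply, smul_eq_mul, h3]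
  rw [Finset.mul_sum]
  exact Finset.sum_congr rfl fun i _ => by ring

/-- The law of large numbers: the frequency of a symbol in a random sequence is its weight. -/
theorem ae_tendsto_frequency {p : ι → ℝ≥0∞} (hp : ∑ i, p i = 1) (i : ι) :
    ∀ᵐ ω ∂bernoulliMeasure p, Tendsto
      (fun n : ℕ => (∑ k ∈ Finset.range n, ({i} : Set ι).indicator (1 : ι → ℝ) (ω k)) / n)
      atTop (𝓝 (p i).toReal) := by
  have := isProbabilityMeasure_weightMeasure hp
  have := isProbabilityMeasure_bernoulliMeasure hp
  set g : ι → ℝ := ({i} : Set ι).indicator 1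
  have hg : Measurable g := Measurable.of_discrete
  have hmap : ∀ k, (bernoulliMeasure p).map (fun ω => ω k) = weightMeasure p := fun k =>
    Measure.infinitePi_map_eval _ k
  have hX : ∀ k, Measurable fun ω : ℕ → ι => g (ω k) := fun k =>
    hg.comp (measurable_pi_apply k)
  have hbd : ∀ j, ‖g j‖ ≤ 1 := fun j => by
    by_cases hj : j ∈ ({i} : Set ι) <;> simp [g, hj]
  have key := ProbabilityTheory.strong_law_ae_real (μ := bernoulliMeasure p)
    (fun k ω => g (ω k))
    (Integrable.of_bound (hX 0).aestronglyMeasurable 1 (ae_of_all _ fun ω => hbd _))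
    (fun k l hkl => (ProbabilityTheory.iIndepFun_infinitePi (P := fun _ => weightMeasure p)
      (X := fun _ => g) fun _ => hg).indepFun hkl)
    (fun k => by
      refine ⟨(hX k).aemeasurable, (hX 0).aemeasurable, ?_⟩
      have h : ∀ k, (bernoulliMeasure p).map (fun ω => g (ω k)) = (weightMeasure p).map g := by
        intro k
        rw [← hmap k, Measure.map_map hg (measurable_pi_apply k)]
        rfl
      rw [h, h])
  have hint : ∫ ω, g (ω 0) ∂bernoulliMeasure p = (p i).toReal := by
    have h1 : (fun ω : ℕ → ι => g (ω 0))
        = ((fun ω : ℕ → ι => ω 0) ⁻¹' {i}).indicator 1 := by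
      funext ω
      simp only [g, Set.indicator]
      rfl
    rw [h1, integral_indicator_one ((measurable_pi_apply 0) (MeasurableSet.singleton i)),
      Measure.real, ← Measure.map_apply (measurable_pi_apply 0) (MeasurableSet.singleton i), hmap,
      weightMeasure_apply, Finset.sum_eq_single i]
    · simp
    · intro j _ hj
      simp [hj]
    · simp
  rw [hint] at key
  exact key

/-- Bernoulli measures with different weights live on disjoint sets of sequences. -/
theorem mutuallySingular_bernoulliMeasure {p q : ι → ℝ≥0∞} (hp : ∑ i, p i = 1)
    (hq : ∑ i, q i = 1) {i : ι} (hpq : p i ≠ q i) :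
    (bernoulliMeasure p).MutuallySingular (bernoulliMeasure q) := by
  set S : Set (ℕ → ι) := {ω | Tendsto
      (fun n : ℕ => (∑ k ∈ Finset.range n, ({i} : Set ι).indicator (1 : ι → ℝ) (ω k)) / n)
      atTop (𝓝 (p i).toReal)} with hS
  have hfin : ∀ {w : ι → ℝ≥0∞}, ∑ i, w i = 1 → w i ≠ ∞ := fun hw =>
    ne_top_of_le_ne_top ENNReal.one_ne_top
      (hw ▸ Finset.single_le_sum (f := _) (fun _ _ => zero_le) (Finset.mem_univ i))
  have hp' : bernoulliMeasure p Sᶜ = 0 := ae_tendsto_frequency hp i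
  have hq' : bernoulliMeasure q S = 0 := by
    refine measure_mono_null (fun ω hω => ?_) (ae_tendsto_frequency hq i)
    intro h
    have := tendsto_nhds_unique hω h
    exact hpq ((ENNReal.toReal_eq_toReal_iff' (hfin hp) (hfin hq)).1 this)
  exact (Measure.MutuallySingular.mk hq' hp' (by simp)).symm

end Bernoulli

/-! ### Coding maps and self-similar measures -/

section IFS

variable {ι X : Type*}

/-- A continuous map `π` from sequences of symbols to `X` that turns the prefixing of a symbol `i`
into the application of `f i`. Its range is the attractor of the family `f`. -/
structure IsCodingMap [TopologicalSpace ι] [TopologicalSpace X] (f : ι → X → X)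
    (π : (ℕ → ι) → X) : Prop where
  continuous : Continuous π
  map_consSeq : ∀ i ω, π (consSeq i ω) = f i (π ω)

/-- The coding map of a family of contractions, as the fixed point of a contraction of the space of
continuous maps. -/
theorem exists_isCodingMap [Fintype ι] [TopologicalSpace ι] [DiscreteTopology ι] [MetricSpace X]
    [CompactSpace X] [Nonempty X] {f : ι → X → X}
    {c : ℝ≥0} (hc : c < 1) (hf : ∀ i, LipschitzWith c (f i)) : ∃ π, IsCodingMap f π := by
  have hF : Continuous fun p : ι × X => f p.1 p.2 :=
    continuous_prod_of_discrete_left.2 fun i => (hf i).continuous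
  let Φ : C(ℕ → ι, X) → C(ℕ → ι, X) := fun g =>
    ⟨fun ω => f (ω 0) (g fun n => ω (n + 1)), by
      have h1 : Continuous fun (ω : ℕ → ι) n => ω (n + 1) :=
        continuous_pi fun n => continuous_apply (n + 1)
      have h2 : Continuous fun ω : ℕ → ι => ω 0 := continuous_apply 0
      exact hF.comp (h2.prodMk (g.continuous.comp h1))⟩
  have hΦ : ContractingWith c Φ := by
    refine ⟨hc, LipschitzWith.of_dist_le_mul fun g h => ?_⟩
    refine (ContinuousMap.dist_le (by positivity)).2 fun ω => ?_
    refine ((hf (ω 0)).dist_le_mul _ _).trans ?_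
    gcongr
    exact ContinuousMap.dist_apply_le_dist _
  have : Nonempty C(ℕ → ι, X) := ⟨ContinuousMap.const _ (Classical.arbitrary X)⟩
  have hfix := hΦ.fixedPoint_isFixedPt
  refine ⟨⇑(ContractingWith.fixedPoint Φ hΦ), ContinuousMap.continuous _, fun i ω => ?_⟩
  conv_lhs => rw [← hfix.eq]
  rfl

namespace IsCodingMap

variable [TopologicalSpace ι] [TopologicalSpace X] {f : ι → X → X} {π : (ℕ → ι) → X}

theorem apply_eq (hπ : IsCodingMap f π) (ω : ℕ → ι) : π ω = f (ω 0) (π fun n => ω (n + 1)) := by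
  rw [← hπ.map_consSeq, consSeq_head_tail]

theorem range_eq_iUnion (hπ : IsCodingMap f π) : range π = ⋃ i, f i '' range π := by
  ext x
  simp only [mem_range, mem_iUnion, mem_image, exists_exists_eq_and]
  constructor
  · rintro ⟨ω, rfl⟩
    exact ⟨ω 0, fun n => ω (n + 1), (hπ.apply_eq ω).symm⟩
  · rintro ⟨i, ω, rfl⟩
    exact ⟨consSeq i ω, hπ.map_consSeq i ω⟩

end IsCodingMap

/-- The image of the whole space under `f (w 0) ∘ ⋯ ∘ f (w (n - 1))`. -/
def wordCell (f : ι → X → X) : (n : ℕ) → (Fin n → ι) → Set X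
  | 0, _ => univ
  | n + 1, w => f (w 0) '' wordCell f n (Fin.tail w)

theorem mem_wordCell [TopologicalSpace ι] [TopologicalSpace X] {f : ι → X → X}
    {π : (ℕ → ι) → X} (hπ : IsCodingMap f π) (n : ℕ) (ω : ℕ → ι) :
    π ω ∈ wordCell f n fun k => ω k := by
  induction n generalizing ω with
  | zero => exact mem_univ _
  | succ n ih =>
    rw [hπ.apply_eq]
    exact mem_image_of_mem _ (ih fun n => ω (n + 1))

theorem ediam_wordCell_le [MetricSpace X] {f : ι → X → X} {ρ : ι → ℝ≥0}
    (hf : ∀ i, LipschitzWith (ρ i) (f i)) (hX : Metric.ediam (univ : Set X) ≤ 1) (n : ℕ)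
    (w : Fin n → ι) : Metric.ediam (wordCell f n w) ≤ ((∏ k, ρ (w k) : ℝ≥0) : ℝ≥0∞) := by
  induction n with
  | zero => simpa [wordCell] using hX
  | succ n ih =>
    rw [Fin.prod_univ_succ, ENNReal.coe_mul]
    refine ((hf (w 0)).ediam_image_le _).trans ?_
    gcongr
    exact ih (Fin.tail w)

theorem prod_le_pow_of_le {ρ : ι → ℝ≥0} {c : ℝ≥0} (hc : ∀ i, ρ i ≤ c) (n : ℕ) (w : Fin n → ι) :
    ∏ k, ρ (w k) ≤ c ^ n := by
  simpa using Finset.prod_le_prod' (s := Finset.univ) fun k _ => hc (w k)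

/-- The attractor has Hausdorff dimension at most the similarity dimension: it is covered by the
cells of the words of length `n`, and the `s`-th powers of their diameters sum to at most `1`. -/
theorem dimH_range_le_of_isCodingMap [Fintype ι] [TopologicalSpace ι] [MetricSpace X]
    [MeasurableSpace X] [BorelSpace X]
    {f : ι → X → X} {π : (ℕ → ι) → X} (hπ : IsCodingMap f π)
    {ρ : ι → ℝ≥0} (hf : ∀ i, LipschitzWith (ρ i) (f i)) {c : ℝ≥0} (hc : c < 1) (hρ : ∀ i, ρ i ≤ c)
    (hX : Metric.ediam (univ : Set X) ≤ 1) {s : ℝ≥0} (hs : ∑ i, ρ i ^ (s : ℝ) = 1) :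
    dimH (range π) ≤ s := by
  refine dimH_le_of_hausdorffMeasure_ne_top (ne_top_of_le_ne_top ENNReal.one_ne_top ?_)
  refine (Measure.hausdorffMeasure_le_liminf_sum (s : ℝ) (range π) (l := atTop)
    (fun n : ℕ => ((c ^ n : ℝ≥0) : ℝ≥0∞)) ?_ (fun n (w : Fin n → ι) => wordCell f n w) ?_ ?_).trans
    ?_
  · exact ENNReal.tendsto_coe.2 (NNReal.tendsto_pow_atTop_nhds_zero_iff.2 hc)
  · refine Eventually.of_forall fun n w => (ediam_wordCell_le hf hX n w).trans ?_
    exact_mod_cast prod_le_pow_of_le hρ n w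
  · refine Eventually.of_forall fun n => ?_
    rintro _ ⟨ω, rfl⟩
    exact mem_iUnion.2 ⟨_, mem_wordCell hπ n ω⟩
  · have key : ∀ n : ℕ, ∑ w : Fin n → ι, Metric.ediam (wordCell f n w) ^ (s : ℝ) ≤ 1 := by
      classical
      intro n
      calc ∑ w : Fin n → ι, Metric.ediam (wordCell f n w) ^ (s : ℝ)
          ≤ ∑ w : Fin n → ι, ((∏ k, ρ (w k) ^ (s : ℝ) : ℝ≥0) : ℝ≥0∞) := by
            refine Finset.sum_le_sum fun w _ => ?_
            rw [NNReal.finsetProd_rpow, ENNReal.coe_rpow_of_nonneg _ s.coe_nonneg]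
            exact ENNReal.rpow_le_rpow (ediam_wordCell_le hf hX n w) s.coe_nonneg
        _ = ((∏ _k : Fin n, ∑ i, ρ i ^ (s : ℝ) : ℝ≥0) : ℝ≥0∞) := by
            rw [Finset.prod_univ_sum, Fintype.piFinset_univ]
            push_cast
            rfl
        _ = 1 := by simp [hs]
    exact liminf_le_of_le (by isBoundedDefault) fun b hb => by
      obtain ⟨n, hn⟩ := hb.exists
      exact hn.trans (key n)

/-- The image under the coding map of a Bernoulli measure is self-similar. -/
theorem IsCodingMap.map_bernoulliMeasure [Fintype ι] [TopologicalSpace ι]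
    [DiscreteTopology ι] [MeasurableSpace ι] [DiscreteMeasurableSpace ι] [MetricSpace X]
    [MeasurableSpace X] [BorelSpace X]
    {f : ι → X → X} {π : (ℕ → ι) → X} (hπ : IsCodingMap f π) (hf : ∀ i, Measurable (f i))
    {p : ι → ℝ≥0∞} (hp : ∑ i, p i = 1) :
    (bernoulliMeasure p).map π = ∑ i, p i • ((bernoulliMeasure p).map π).map (f i) := by
  have hm : Measurable π := hπ.continuous.measurable
  conv_lhs => rw [← sum_map_consSeq_bernoulliMeasure hp]
  rw [← Measure.mapₗ_apply_of_measurable hm, map_sum]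
  refine Finset.sum_congr rfl fun i _ => ?_
  rw [map_smul, Measure.mapₗ_apply_of_measurable hm, Measure.map_map hm (measurable_consSeq i),
    Measure.map_map (hf i) hm]
  congr 2
  exact funext (hπ.map_consSeq i)

/-- The weights of an invariance equation bound from below the mass of the cells. -/
theorem prod_le_measure_wordCell [Fintype ι] [MeasurableSpace X] {f : ι → X → X}
    (hf : ∀ i, Measurable (f i)) {μ : Measure X} [IsProbabilityMeasure μ] {p : ι → ℝ≥0∞}
    (hμ : μ = ∑ i, p i • μ.map (f i)) (n : ℕ) (w : Fin n → ι) :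
    ∏ k, p (w k) ≤ μ (wordCell f n w) := by
  induction n with
  | zero => simp [wordCell]
  | succ n ih =>
    rw [Fin.prod_univ_succ]
    calc p (w 0) * ∏ k : Fin n, p (w k.succ)
        ≤ p (w 0) * μ.map (f (w 0)) (f (w 0) '' wordCell f n (Fin.tail w)) := by
          gcongr
          refine (ih (Fin.tail w)).trans ?_
          exact (measure_mono (subset_preimage_image _ _)).trans
            (Measure.le_map_apply (hf _).aemeasurable _)
      _ ≤ ∑ i, p i * μ.map (f i) (f (w 0) '' wordCell f n (Fin.tail w)) :=
          Finset.single_le_sum (f := fun i => p i * μ.map (f i) _) (fun _ _ => zero_le)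
            (Finset.mem_univ _)
      _ = μ (f (w 0) '' wordCell f n (Fin.tail w)) := by
          conv_rhs => rw [hμ]
          simp

/-- For positive weights, the attractor is the support of the self-similar measure. -/
theorem IsCodingMap.support_map_bernoulliMeasure [Fintype ι] [TopologicalSpace ι]
    [DiscreteTopology ι] [MeasurableSpace ι] [DiscreteMeasurableSpace ι] [MetricSpace X]
    [MeasurableSpace X] [BorelSpace X]
    {f : ι → X → X} {π : (ℕ → ι) → X} (hπ : IsCodingMap f π)
    {c : ℝ≥0} (hc : c < 1) (hf : ∀ i, LipschitzWith c (f i))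
    (hX : Metric.ediam (univ : Set X) ≤ 1)
    {p : ι → ℝ≥0∞} (hp : ∑ i, p i = 1) (hpos : ∀ i, p i ≠ 0) :
    ((bernoulliMeasure p).map π).support = range π := by
  have hm : Measurable π := hπ.continuous.measurable
  have := isProbabilityMeasure_bernoulliMeasure hp
  have : IsProbabilityMeasure ((bernoulliMeasure p).map π) :=
    Measure.isProbabilityMeasure_map hm.aemeasurable
  have hfm : ∀ i, Measurable (f i) := fun i => (hf i).continuous.measurable
  refine Subset.antisymm ?_ ?_
  · refine Measure.support_subset_of_isClosed (isCompact_range hπ.continuous).isClosed ?_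
    exact (ae_map_iff hm.aemeasurable (isCompact_range hπ.continuous).measurableSet).2
      (ae_of_all _ fun ω => mem_range_self ω)
  · rintro _ ⟨ω, rfl⟩
    rw [Measure.mem_support_iff_forall]
    intro U hU
    obtain ⟨ε, hε, hεU⟩ := EMetric.mem_nhds_iff.1 hU
    have ht : Tendsto (fun n : ℕ => ((c ^ n : ℝ≥0) : ℝ≥0∞)) atTop (𝓝 0) :=
      ENNReal.tendsto_coe.2 (NNReal.tendsto_pow_atTop_nhds_zero_iff.2 hc)
    obtain ⟨n, hn⟩ := (ht.eventually_lt_const hε).exists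
    have hsub : wordCell f n (fun k => ω k) ⊆ U := by
      intro y hy
      refine hεU (lt_of_le_of_lt ?_ hn)
      refine (Metric.edist_le_ediam_of_mem hy (mem_wordCell hπ n ω)).trans ?_
      simpa using ediam_wordCell_le hf hX n fun k => ω k
    have hcell := prod_le_measure_wordCell hfm (hπ.map_bernoulliMeasure hfm hp) n fun k => ω k
    refine lt_of_lt_of_le ?_ (hcell.trans (measure_mono hsub))
    exact pos_iff_ne_zero.2 (Finset.prod_ne_zero_iff.2 fun k _ => hpos _)

/-- If the cells overlap only in sets that are null for both self-similar measures, then distinct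
codes almost surely have distinct images, so that the mutual singularity of the Bernoulli measures
descends to their images. -/
theorem IsCodingMap.mutuallySingular_map [Fintype ι] [TopologicalSpace ι]
    [DiscreteTopology ι] [MeasurableSpace ι] [DiscreteMeasurableSpace ι] [MetricSpace X]
    [MeasurableSpace X] [BorelSpace X] [SecondCountableTopology X]
    {f : ι → X → X} {π : (ℕ → ι) → X} (hπ : IsCodingMap f π)
    (hinj : ∀ i, Function.Injective (f i))
    {B : Set X} (hBm : MeasurableSet B) (hB : ∀ i j, i ≠ j → range (f i) ∩ range (f j) ⊆ B)
    {p q : ι → ℝ≥0∞} (hp : ∑ i, p i = 1) (hq : ∑ i, q i = 1) {i : ι} (hpq : p i ≠ q i)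
    (hpB : (bernoulliMeasure p).map π B = 0) (hqB : (bernoulliMeasure q).map π B = 0) :
    ((bernoulliMeasure p).map π).MutuallySingular ((bernoulliMeasure q).map π) := by
  have hm : Measurable π := hπ.continuous.measurable
  have htail : ∀ n : ℕ, Measurable fun (ω : ℕ → ι) k => ω (n + k) := fun n =>
    measurable_pi_lambda _ fun k => measurable_pi_apply _
  -- the codes of which no tail is mapped into an overlap
  set G : Set (ℕ → ι) := {ω | ∀ n : ℕ, π (fun k => ω (n + k)) ∉ B} with hG
  have hGm : MeasurableSet G := by
    rw [hG, ofPred_forall]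
    exact MeasurableSet.iInter fun n => ((hm.comp (htail n)) hBm).compl
  have hGnull : ∀ {w : ι → ℝ≥0∞}, ∑ i, w i = 1 → (bernoulliMeasure w).map π B = 0 →
      bernoulliMeasure w Gᶜ = 0 := by
    intro w hw hwB
    have := isProbabilityMeasure_weightMeasure hw
    have hsub : Gᶜ = ⋃ n : ℕ, (fun (ω : ℕ → ι) k => ω (n + k)) ⁻¹' (π ⁻¹' B) := by
      ext ω
      simp [hG]
    rw [hsub, measure_iUnion_null_iff]
    intro n
    rw [← Measure.map_apply (htail n) (hm hBm)]
    have hmap : (bernoulliMeasure w).map (fun (ω : ℕ → ι) k => ω (n + k)) = bernoulliMeasure w :=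
      Measure.map_infinitePi_infinitePi_of_inj (P := fun _ : ℕ => weightMeasure w)
        (add_right_injective n)
    rw [hmap, ← Measure.map_apply hm hBm, hwB]
  have hGinj : InjOn π G := by
    intro ω hω ω' hω' h
    have key : ∀ n : ℕ, (∀ k < n, ω k = ω' k) ∧
        π (fun k => ω (n + k)) = π (fun k => ω' (n + k)) := by
      intro n
      induction n with
      | zero => simpa using h
      | succ n ih =>
        have h1 := hπ.apply_eq fun k => ω (n + k)
        have h2 := hπ.apply_eq fun k => ω' (n + k)
        have hn : ω n = ω' n := by
          by_contra hne
          refine hω n (hB _ _ hne ⟨⟨_, h1.symm⟩, ?_⟩)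
          rw [ih.2]
          exact ⟨_, h2.symm⟩
        refine ⟨fun k hk => ?_, ?_⟩
        · rcases Nat.lt_succ_iff_lt_or_eq.1 hk with hk | rfl
          · exact ih.1 k hk
          · exact hn
        · rw [ih.2, h2] at h1
          simp only [Nat.add_zero, hn] at h1
          have h3 := hinj _ h1.symm
          simpa only [Nat.add_assoc, Nat.add_comm, Nat.add_left_comm] using h3
    exact funext fun k => (key (k + 1)).1 k (Nat.lt_succ_self k)
  obtain ⟨S, hSm, hpS, hqS⟩ := mutuallySingular_bernoulliMeasure hp hq hpq
  have himg : MeasurableSet (π '' (S ∩ G)) :=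
    (hSm.inter hGm).image_of_measurable_injOn hm (hGinj.mono inter_subset_right)
  refine ⟨π '' (S ∩ G), himg, ?_, ?_⟩
  · rw [Measure.map_apply hm himg]
    refine measure_mono_null (t := S ∪ Gᶜ) ?_ (measure_union_null hpS (hGnull hp hpB))
    rintro ω ⟨ω', hω', h⟩
    by_cases hω : ω ∈ G
    · exact Or.inl (hGinj hω'.2 hω h ▸ hω'.1)
    · exact Or.inr hω
  · rw [Measure.map_apply hm himg.compl]
    refine measure_mono_null (t := Sᶜ ∪ Gᶜ) ?_ (measure_union_null hqS (hGnull hq hqB))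
    intro ω hω
    by_contra hcon
    simp only [mem_union, mem_compl_iff, not_or, not_not] at hcon
    exact hω (mem_image_of_mem _ hcon)

end IFS

/-! ### The lower bound for the dimension -/

section LowerBound

variable {ι X : Type*} [Fintype ι] [MetricSpace X] [MeasurableSpace X] [BorelSpace X]

/-- The mass of a set `U` is compared with the volume of its `δ`-thickening, by downward induction
on the scale `δ`. Volume enters through a reference measure `vol` of dimension `d`; that it is
subinvariant under the family with the weights `ρ i ^ d` expresses that the cells do not overlap,
and makes it possible to add up the estimates in the cells. -/
theorem measure_le_measure_thickening {f : ι → X → X} {ρ : ι → ℝ} {m M : ℝ} (hm : 0 < m)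
    (hmρ : ∀ i, m ≤ ρ i) (hρM : ∀ i, ρ i ≤ M) (hM : M < 1)
    (hf : ∀ i x y, dist (f i x) (f i y) ≤ ρ i * dist x y)
    {d s a : ℝ} (hd : 0 ≤ d) (hsd : s ≤ d) (ha : 0 < a) {vol ν : Measure X} [IsProbabilityMeasure ν]
    (hvol : ∑ i, ENNReal.ofReal (ρ i ^ d) • vol.map (f i) ≤ vol)
    (hball : ∀ x, ∀ δ ∈ Ioc (0 : ℝ) 1, ENNReal.ofReal (a * δ ^ d) ≤ vol (Metric.ball x δ))
    (hν : ν = ∑ i, ENNReal.ofReal (ρ i ^ s) • ν.map (f i)) (δ : ℝ) (hδ : δ ∈ Ioc (0 : ℝ) 1)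
    (U : Set X) (hU : MeasurableSet U) :
    ν U ≤ ENNReal.ofReal ((a * m ^ d)⁻¹ * δ ^ (s - d)) * vol (Metric.thickening δ U) := by
  have hfm : ∀ i, Measurable (f i) := fun i =>
    (LipschitzWith.of_dist_le' (hf i)).continuous.measurable
  have hρ : ∀ i, 0 < ρ i := fun i => hm.trans_le (hmρ i)
  have main : ∀ n : ℕ, ∀ δ : ℝ, m * M ^ n ≤ δ → 0 < δ → δ ≤ 1 → ∀ U : Set X, MeasurableSet U →
      ν U ≤ ENNReal.ofReal ((a * m ^ d)⁻¹ * δ ^ (s - d)) * vol (Metric.thickening δ U) := by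
    -- at scales above `m`, the thickening of a nonempty set contains a large ball
    have base : ∀ δ : ℝ, m ≤ δ → 0 < δ → δ ≤ 1 → ∀ U : Set X,
        ν U ≤ ENNReal.ofReal ((a * m ^ d)⁻¹ * δ ^ (s - d)) * vol (Metric.thickening δ U) := by
      intro δ hmδ hδ0 hδ1 U
      rcases U.eq_empty_or_nonempty with rfl | ⟨z, hz⟩
      · simp
      have h1 : (1 : ℝ) ≤ (a * m ^ d)⁻¹ * δ ^ (s - d) * (a * δ ^ d) := by
        have e1 : (1 : ℝ) ≤ δ ^ (s - d) :=
          Real.one_le_rpow_of_pos_of_le_one_of_nonpos hδ0 hδ1 (by linarith)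
        have e2 : m ^ d ≤ δ ^ d := Real.rpow_le_rpow hm.le hmδ hd
        have e3 : 0 < m ^ d := Real.rpow_pos_of_pos hm d
        calc (1 : ℝ) = (a * m ^ d)⁻¹ * 1 * (a * m ^ d) := by field_simp
          _ ≤ _ := by gcongr
      calc ν U ≤ 1 := prob_le_one
        _ ≤ ENNReal.ofReal ((a * m ^ d)⁻¹ * δ ^ (s - d) * (a * δ ^ d)) := by
          rw [← ENNReal.ofReal_one]
          exact ENNReal.ofReal_le_ofReal h1
        _ = ENNReal.ofReal ((a * m ^ d)⁻¹ * δ ^ (s - d)) * ENNReal.ofReal (a * δ ^ d) :=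
          ENNReal.ofReal_mul (by positivity)
        _ ≤ _ := by
          gcongr
          refine (hball z δ ⟨hδ0, hδ1⟩).trans (measure_mono ?_)
          exact Metric.ball_subset_thickening hz δ
    intro n
    induction n with
    | zero => exact fun δ hmδ h0 h1 U _ => base δ (by simpa using hmδ) h0 h1 U
    | succ n ih =>
      intro δ hmδ h0 h1 U hU
      by_cases hδm : m ≤ δ
      · exact base δ hδm h0 h1 U
      push Not at hδm
      have hcell : ∀ i, ν (f i ⁻¹' U) ≤ ENNReal.ofReal ((a * m ^ d)⁻¹ * (δ / ρ i) ^ (s - d)) *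
          vol (f i ⁻¹' Metric.thickening δ U) := by
        intro i
        have hM0 : 0 < M := (hρ i).trans_le (hρM i)
        refine (ih (δ / ρ i) ?_ (div_pos h0 (hρ i)) ?_ _ (hfm i hU)).trans ?_
        · rw [le_div_iff₀ (hρ i)]
          calc m * M ^ n * ρ i ≤ m * M ^ n * M := by
                gcongr
                exact hρM i
            _ = m * M ^ (n + 1) := by ring
            _ ≤ δ := hmδ
        · rw [div_le_one (hρ i)]
          exact hδm.le.trans (hmρ i)
        · gcongr
          intro x hx
          obtain ⟨z, hz, hxz⟩ := Metric.mem_thickening_iff.1 hx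
          refine Metric.mem_thickening_iff.2 ⟨f i z, hz, (hf i x z).trans_lt ?_⟩
          rwa [lt_div_iff₀' (hρ i)] at hxz
      have hthick : MeasurableSet (Metric.thickening δ U) := Metric.isOpen_thickening.measurableSet
      calc ν U = ∑ i, ENNReal.ofReal (ρ i ^ s) * ν (f i ⁻¹' U) := by
            conv_lhs => rw [hν]
            simp only [Measure.coe_finsetSum, Finset.sum_apply, Measure.smul_apply, smul_eq_mul]
            exact Finset.sum_congr rfl fun i _ => by rw [Measure.map_apply (hfm i) hU]
        _ ≤ ∑ i, ENNReal.ofReal ((a * m ^ d)⁻¹ * δ ^ (s - d)) *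
              (ENNReal.ofReal (ρ i ^ d) * vol (f i ⁻¹' Metric.thickening δ U)) := by
            refine Finset.sum_le_sum fun i _ => ?_
            refine (mul_le_mul_right (hcell i) _).trans_eq ?_
            have e1 := Real.rpow_pos_of_pos (hρ i) d
            have e2 := Real.rpow_pos_of_pos (hρ i) s
            have e3 := Real.rpow_pos_of_pos hm d
            rw [← mul_assoc, ← mul_assoc, ← ENNReal.ofReal_mul e2.le,
              ← ENNReal.ofReal_mul (by positivity), Real.div_rpow h0.le (hρ i).le,
              Real.rpow_sub (hρ i)]
            congr 2
            field_simp
        _ = ENNReal.ofReal ((a * m ^ d)⁻¹ * δ ^ (s - d)) *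
              (∑ i, ENNReal.ofReal (ρ i ^ d) • vol.map (f i)) (Metric.thickening δ U) := by
            rw [← Finset.mul_sum]
            simp only [Measure.coe_finsetSum, Finset.sum_apply, Measure.smul_apply, smul_eq_mul]
            congr 1
            exact Finset.sum_congr rfl fun i _ => by rw [Measure.map_apply (hfm i) hthick]
        _ ≤ _ := by
            gcongr
  rcases isEmpty_or_nonempty ι with hι | ⟨⟨i⟩⟩
  · exact absurd (by rw [hν]; simp) (IsProbabilityMeasure.ne_zero ν)
  have hM0 : 0 < M := (hρ i).trans_le (hρM i)
  obtain ⟨n, hn⟩ := exists_pow_lt_of_lt_one (div_pos hδ.1 hm) hM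
  refine main n δ ?_ hδ.1 hδ.2 U hU
  rw [lt_div_iff₀' hm] at hn
  exact hn.le

/-- The mass distribution principle: a set that is charged by a measure for which the mass of a ball
of radius `δ` is at most of the order `δ ^ s` has Hausdorff dimension at least `s`. -/
theorem le_dimH_of_measure_closedBall_le {ν : Measure X} {c : ℝ} (hc : 0 < c) {s : ℝ≥0}
    (hν : ∀ x, ∀ δ ∈ Ioc (0 : ℝ) 1, ν (Metric.closedBall x δ) ≤ ENNReal.ofReal (c * δ ^ (s : ℝ)))
    {K : Set X} (hK : ν K ≠ 0) : (s : ℝ≥0∞) ≤ dimH K := by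
  have hc0 : ENNReal.ofReal c ≠ 0 := by simpa using hc
  have key : (ENNReal.ofReal c)⁻¹ • ν ≤ Measure.hausdorffMeasure (s : ℝ) := by
    refine Measure.le_hausdorffMeasure _ _ (1 / 2) (by simp) fun S hS => ?_
    rcases S.eq_empty_or_nonempty with rfl | ⟨x, hx⟩
    · simp
    have hfin : Metric.ediam S ≠ ∞ := ne_top_of_le_ne_top (by simp) hS
    set D := (Metric.ediam S).toReal with hD
    have hSD : Metric.ediam S = ENNReal.ofReal D := (ENNReal.ofReal_toReal hfin).symm
    have hD0 : 0 ≤ D := ENNReal.toReal_nonneg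
    have hD1 : D < 1 := by
      have : D ≤ 1 / 2 := by
        simpa [hD] using ENNReal.toReal_mono (by simp) hS
      linarith
    have hle : ν S ≤ ENNReal.ofReal (c * D ^ (s : ℝ)) := by
      have hlim : Tendsto (fun δ : ℝ => ENNReal.ofReal (c * δ ^ (s : ℝ))) (𝓝[>] D)
          (𝓝 (ENNReal.ofReal (c * D ^ (s : ℝ)))) := by
        refine Tendsto.mono_left ?_ nhdsWithin_le_nhds
        refine (ENNReal.continuous_ofReal.comp ?_).tendsto D
        exact continuous_const.mul (Real.continuous_rpow_const s.coe_nonneg)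
      refine ge_of_tendsto hlim ?_
      filter_upwards [Ioc_mem_nhdsGT hD1] with δ hδ
      refine (measure_mono fun y hy => ?_).trans (hν x δ ⟨hD0.trans_lt hδ.1, hδ.2⟩)
      rw [Metric.mem_closedBall, dist_edist]
      exact (ENNReal.toReal_mono hfin (Metric.edist_le_ediam_of_mem hy hx)).trans hδ.1.le
    rw [Measure.smul_apply, smul_eq_mul, hSD, ENNReal.ofReal_rpow_of_nonneg hD0 s.coe_nonneg,
      ENNReal.inv_mul_le_iff hc0 ENNReal.ofReal_ne_top, ← ENNReal.ofReal_mul hc.le]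
    exact hle
  refine le_dimH_of_hausdorffMeasure_ne_zero fun h => ?_
  have := (key K).trans_eq h
  simp only [Measure.smul_apply, smul_eq_mul, nonpos_iff_eq_zero, mul_eq_zero, hK, or_false,
    ENNReal.inv_eq_zero, ENNReal.ofReal_ne_top] at this

/-- The attractor has Hausdorff dimension at least the similarity dimension `s`, provided that there
is a subinvariant reference measure `vol` for which balls of radius `δ` have measure of the order
`δ ^ d`, with `s ≤ d`. -/
theorem IsCodingMap.le_dimH_range [TopologicalSpace ι] [DiscreteTopology ι]
    {f : ι → X → X} {π : (ℕ → ι) → X} (hπ : IsCodingMap f π)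
    {ρ : ι → ℝ} {m M : ℝ} (hm : 0 < m)
    (hmρ : ∀ i, m ≤ ρ i) (hρM : ∀ i, ρ i ≤ M) (hM : M < 1)
    (hf : ∀ i x y, dist (f i x) (f i y) ≤ ρ i * dist x y)
    {d a b : ℝ} {s : ℝ≥0} (hsd : s ≤ d) (ha : 0 < a) (hb : 0 < b) {vol : Measure X}
    (hvol : ∑ i, ENNReal.ofReal (ρ i ^ d) • vol.map (f i) ≤ vol)
    (hball : ∀ x, ∀ δ ∈ Ioc (0 : ℝ) 1, ENNReal.ofReal (a * δ ^ d) ≤ vol (Metric.ball x δ))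
    (hball' : ∀ x, ∀ δ > 0, vol (Metric.ball x δ) ≤ ENNReal.ofReal (b * δ ^ d))
    (hsum : ∑ i, ρ i ^ (s : ℝ) = 1) : (s : ℝ≥0∞) ≤ dimH (range π) := by
  let _ : MeasurableSpace ι := ⊤
  have hρ : ∀ i, 0 < ρ i := fun i => hm.trans_le (hmρ i)
  have hd : 0 ≤ d := s.coe_nonneg.trans hsd
  -- the weights of the measure to which the mass distribution principle is applied
  set p : ι → ℝ≥0∞ := fun i => ENNReal.ofReal (ρ i ^ (s : ℝ)) with hp
  have hp1 : ∑ i, p i = 1 := by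
    rw [hp, ← ENNReal.ofReal_sum_of_nonneg fun i _ => (Real.rpow_pos_of_pos (hρ i) _).le, hsum,
      ENNReal.ofReal_one]
  have := isProbabilityMeasure_bernoulliMeasure hp1
  have hπm : Measurable π := hπ.continuous.measurable
  set ν := (bernoulliMeasure p).map π with hν
  have : IsProbabilityMeasure ν := Measure.isProbabilityMeasure_map hπm.aemeasurable
  have hfm : ∀ i, Measurable (f i) := fun i =>
    (LipschitzWith.of_dist_le' (hf i)).continuous.measurable
  have h2 : (0 : ℝ) < 2 ^ d := by positivity
  have h3 : (0 : ℝ) < m ^ d := Real.rpow_pos_of_pos hm d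
  refine le_dimH_of_measure_closedBall_le (ν := ν) (c := (a * m ^ d)⁻¹ * (b * 2 ^ d))
    (by positivity) (fun x δ hδ => ?_) (K := range π) ?_
  · calc ν (Metric.closedBall x δ)
        ≤ ENNReal.ofReal ((a * m ^ d)⁻¹ * δ ^ ((s : ℝ) - d)) *
            vol (Metric.thickening δ (Metric.closedBall x δ)) :=
          measure_le_measure_thickening hm hmρ hρM hM hf hd hsd ha hvol hball
            (hπ.map_bernoulliMeasure hfm hp1) δ hδ _ Metric.isClosed_closedBall.measurableSet
      _ ≤ ENNReal.ofReal ((a * m ^ d)⁻¹ * δ ^ ((s : ℝ) - d)) *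
            ENNReal.ofReal (b * (2 * δ) ^ d) := by
          gcongr
          refine (measure_mono fun y hy => ?_).trans (hball' x (2 * δ) (by linarith [hδ.1]))
          obtain ⟨z, hz, hyz⟩ := Metric.mem_thickening_iff.1 hy
          rw [Metric.mem_ball]
          linarith [dist_triangle y z x, Metric.mem_closedBall.1 hz]
      _ = ENNReal.ofReal ((a * m ^ d)⁻¹ * (b * 2 ^ d) * δ ^ (s : ℝ)) := by
          have := Real.rpow_pos_of_pos hδ.1 d
          rw [← ENNReal.ofReal_mul (by have := hδ.1; positivity), Real.rpow_sub hδ.1,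
            Real.mul_rpow zero_le_two hδ.1.le]
          congr 1
          field_simp
  · rw [hν, Measure.map_apply hπm (isCompact_range hπ.continuous).measurableSet, preimage_range,
      measure_univ]
    exact one_ne_zero

end LowerBound

/-! ### Copulas and measures with uniform margins -/

section Copula

theorem Icc_zero_eq_Iic (u : I) : Icc 0 u = Iic u :=
  Set.ext fun x => ⟨fun h => h.2, fun h => ⟨x.2.1, h⟩⟩

theorem IsCopula.sub_le_left {C : I × I → ℝ} (hC : IsCopula C) {a b : I} (hab : a ≤ b) (v : I) :
    C (a, v) ≤ C (b, v) ∧ C (b, v) - C (a, v) ≤ b - a := by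
  have h1 := hC.volume_nonneg a b 0 v hab v.2.1
  have h2 := hC.volume_nonneg a b v 1 hab v.2.2
  rw [hC.zero_right, hC.zero_right] at h1
  rw [hC.one_right, hC.one_right] at h2
  constructor <;> linarith

theorem IsCopula.sub_le_right {C : I × I → ℝ} (hC : IsCopula C) {a b : I} (hab : a ≤ b) (u : I) :
    C (u, a) ≤ C (u, b) ∧ C (u, b) - C (u, a) ≤ b - a := by
  have h1 := hC.volume_nonneg 0 u a b u.2.1 hab
  have h2 := hC.volume_nonneg u 1 a b u.2.2 hab
  rw [hC.zero_left, hC.zero_left] at h1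
  rw [hC.one_left, hC.one_left] at h2
  constructor <;> linarith

/-- Copulas are Lipschitz continuous. -/
theorem IsCopula.continuous {C : I × I → ℝ} (hC : IsCopula C) : Continuous C := by
  have hl : ∀ a b v : I, dist (C (a, v)) (C (b, v)) ≤ dist a b := by
    intro a b v
    rw [Subtype.dist_eq, Real.dist_eq, Real.dist_eq]
    rcases le_total a b with h | h
    · have h1 := hC.sub_le_left h v
      have h2 : (a : ℝ) ≤ b := h
      rw [abs_sub_comm, abs_of_nonneg (by linarith), abs_sub_comm, abs_of_nonneg (by linarith)]
      exact h1.2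
    · have h1 := hC.sub_le_left h v
      have h2 : (b : ℝ) ≤ a := h
      rw [abs_of_nonneg (by linarith), abs_of_nonneg (by linarith)]
      exact h1.2
  have hr : ∀ a b u : I, dist (C (u, a)) (C (u, b)) ≤ dist a b := by
    intro a b u
    rw [Subtype.dist_eq, Real.dist_eq, Real.dist_eq]
    rcases le_total a b with h | h
    · have h1 := hC.sub_le_right h u
      have h2 : (a : ℝ) ≤ b := h
      rw [abs_sub_comm, abs_of_nonneg (by linarith), abs_sub_comm, abs_of_nonneg (by linarith)]
      exact h1.2
    · have h1 := hC.sub_le_right h u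
      have h2 : (b : ℝ) ≤ a := h
      rw [abs_of_nonneg (by linarith), abs_of_nonneg (by linarith)]
      exact h1.2
  refine (LipschitzWith.of_dist_le_mul (K := 2) fun p q => ?_).continuous
  have h1 := hl p.1 q.1 p.2
  have h2 := hr p.2 q.2 q.1
  have h3 : dist p.1 q.1 ≤ dist p q := le_max_left _ _
  have h4 : dist p.2 q.2 ≤ dist p q := le_max_right _ _
  push_cast
  linarith [dist_triangle (C p) (C (q.1, p.2)) (C q)]

theorem IsCopula.apply_eq_of_left {C D : I × I → ℝ} (hC : IsCopula C) (hD : IsCopula D) {u : I}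
    (hu : u = 0 ∨ u = 1) (v : I) : C (u, v) = D (u, v) := by
  rcases hu with rfl | rfl
  · rw [hC.zero_left, hD.zero_left]
  · rw [hC.one_left, hD.one_left]

theorem IsCopula.apply_eq_of_right {C D : I × I → ℝ} (hC : IsCopula C) (hD : IsCopula D) {v : I}
    (hv : v = 0 ∨ v = 1) (u : I) : C (u, v) = D (u, v) := by
  rcases hv with rfl | rfl
  · rw [hC.zero_right, hD.zero_right]
  · rw [hC.one_right, hD.one_right]

/-- The distribution function of a measure on the unit square. -/
noncomputable def squareCdf (μ : Measure (I × I)) (p : I × I) : ℝ := μ.real (Iic p.1 ×ˢ Iic p.2)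

theorem isCopulaMeasure_squareCdf (μ : Measure (I × I)) [IsProbabilityMeasure μ] :
    IsCopulaMeasure (squareCdf μ) μ :=
  ⟨inferInstance, fun u v => by
    rw [Icc_zero_eq_Iic, Icc_zero_eq_Iic, squareCdf, ofReal_measureReal]⟩

/-- The distribution function of a measure with uniform margins is a copula. -/
theorem isCopula_squareCdf (μ : Measure (I × I)) [IsProbabilityMeasure μ]
    (h1 : μ.map Prod.fst = volume) (h2 : μ.map Prod.snd = volume) : IsCopula (squareCdf μ) := by
  have hfst : ∀ u : I, μ (Prod.fst ⁻¹' Iic u) = ENNReal.ofReal u := fun u => by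
    rw [← Measure.map_apply measurable_fst measurableSet_Iic, h1, unitInterval.volume_Iic]
  have hsnd : ∀ u : I, μ (Prod.snd ⁻¹' Iic u) = ENNReal.ofReal u := fun u => by
    rw [← Measure.map_apply measurable_snd measurableSet_Iic, h2, unitInterval.volume_Iic]
  have hone : Iic (1 : I) = univ := eq_univ_of_forall fun x => x.2.2
  have hm : ∀ a b : I, MeasurableSet (Iic a ×ˢ Iic b) := fun a b =>
    measurableSet_Iic.prod measurableSet_Iic
  refine ⟨fun p => ⟨measureReal_nonneg, measureReal_le_one⟩, fun v => ?_, fun u => ?_, fun v => ?_,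
    fun u => ?_, fun a₁ b₁ a₂ b₂ h₁ h₂ => ?_⟩
  · have : μ (Iic (0 : I) ×ˢ Iic v) = 0 :=
      measure_mono_null (fun p hp => hp.1) ((hfst 0).trans (by simp))
    rw [squareCdf, Measure.real, this, ENNReal.toReal_zero]
  · have : μ (Iic u ×ˢ Iic (0 : I)) = 0 :=
      measure_mono_null (fun p hp => hp.2) ((hsnd 0).trans (by simp))
    rw [squareCdf, Measure.real, this, ENNReal.toReal_zero]
  · simp only [squareCdf, hone, univ_prod, Measure.real, hsnd]
    exact ENNReal.toReal_ofReal v.2.1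
  · simp only [squareCdf, hone, prod_univ, Measure.real, hfst]
    exact ENNReal.toReal_ofReal u.2.1
  · have e1 : ∀ v : I, squareCdf μ (b₁, v) - squareCdf μ (a₁, v) = μ.real (Ioc a₁ b₁ ×ˢ Iic v) := by
      intro v
      rw [squareCdf, squareCdf, ← measureReal_sdiff (prod_mono_left (Iic_subset_Iic.2 h₁)) (hm _ _)]
      congr 1
      ext ⟨x, y⟩
      simp only [Set.mem_sdiff, mem_prod, mem_Iic, mem_Ioc, not_and, not_le]
      constructor
      · rintro ⟨⟨hx, hy⟩, h⟩
        exact ⟨⟨lt_of_not_ge fun hxa => absurd (h hxa) (not_lt.2 hy), hx⟩, hy⟩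
      · rintro ⟨⟨ha, hx⟩, hy⟩
        exact ⟨⟨hx, hy⟩, fun h => absurd h (not_le.2 ha)⟩
    have e2 : μ.real (Ioc a₁ b₁ ×ˢ Iic a₂) ≤ μ.real (Ioc a₁ b₁ ×ˢ Iic b₂) :=
      measureReal_mono (prod_mono_right (Iic_subset_Iic.2 h₂))
    linarith [e1 a₂, e1 b₂]

theorem IsCopulaMeasure.measureReal_box {C : I × I → ℝ} {μ : Measure (I × I)} (hC : IsCopula C)
    (h : IsCopulaMeasure C μ) (u v : I) : μ.real (Iic u ×ˢ Iic v) = C (u, v) := by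
  rw [Measure.real, ← Icc_zero_eq_Iic, ← Icc_zero_eq_Iic, h.measure_box,
    ENNReal.toReal_ofReal (hC.mem_Icc _).1]

theorem isCopulaMeasure_of_measureReal_box {C : I × I → ℝ} {μ : Measure (I × I)}
    [IsProbabilityMeasure μ] (h : ∀ u v, μ.real (Iic u ×ˢ Iic v) = C (u, v)) :
    IsCopulaMeasure C μ := by
  obtain rfl : squareCdf μ = C := funext fun p => h p.1 p.2
  exact isCopulaMeasure_squareCdf μ

/-- A finite measure on the unit square is determined by its distribution function. -/
theorem ext_of_squareCdf {μ ν : Measure (I × I)} [IsFiniteMeasure μ] [IsFiniteMeasure ν]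
    (h : ∀ u v : I, μ.real (Iic u ×ˢ Iic v) = ν.real (Iic u ×ˢ Iic v)) : μ = ν := by
  have h' : ∀ u v : I, μ (Iic u ×ˢ Iic v) = ν (Iic u ×ˢ Iic v) := fun u v =>
    (measureReal_eq_measureReal_iff).1 (h u v)
  have h1 : MeasurableSpace.generateFrom (range (Iic : I → Set I))
      = (inferInstance : MeasurableSpace I) :=
    ((BorelSpace.measurable_eq (α := I)).trans (borel_eq_generateFrom_Iic I)).symm
  have hone : Iic (1 : I) = univ := eq_univ_of_forall fun x => x.2.2
  have hs : IsCountablySpanning (range (Iic : I → Set I)) :=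
    ⟨fun _ => univ, fun _ => ⟨1, hone⟩, iUnion_const _⟩
  have hpi : IsPiSystem (range (Iic : I → Set I)) := isPiSystem_Iic
  refine ext_of_generate_finite _ (generateFrom_eq_prod h1 h1 hs hs).symm (hpi.prod hpi) ?_ ?_
  · rintro _ ⟨_, ⟨u, rfl⟩, _, ⟨v, rfl⟩, rfl⟩
    exact h' u v
  · simpa [hone] using h' 1 1

/-- Copulas with pairwise mutually singular measures are linearly independent: in a linear relation,
a measure with positive coefficient would be absolutely continuous with respect to a combination
of the others. -/
theorem linearIndependent_of_mutuallySingular {α : Type*} {C : α → C(I × I, ℝ)}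
    {μ : α → Measure (I × I)} (hC : ∀ i, IsCopula (C i)) (hμ : ∀ i, IsCopulaMeasure (C i) (μ i))
    (h : ∀ i j, i ≠ j → (μ i).MutuallySingular (μ j)) : LinearIndependent ℝ C := by
  have hprob : ∀ i, IsProbabilityMeasure (μ i) := fun i => (hμ i).isProbabilityMeasure
  have key : ∀ (s : Finset α) (g : α → ℝ), ∑ i ∈ s, g i • C i = 0 → ∀ i ∈ s, g i ≤ 0 := by
    intro s g hg i hi
    by_contra! hpos
    have hfin : ∀ k : α → ℝ, IsFiniteMeasure (∑ j ∈ s, ENNReal.ofReal (k j) • μ j) := fun k =>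
      ⟨by simp [ENNReal.sum_lt_top]⟩
    have := hfin g
    have := hfin fun j => -g j
    have hreal : ∀ (k : α → ℝ) (u v : I),
        (∑ j ∈ s, ENNReal.ofReal (k j) • μ j).real (Iic u ×ˢ Iic v)
          = ∑ j ∈ s, max (k j) 0 * C j (u, v) := by
      intro k u v
      simp only [Measure.real, Measure.coe_finsetSum, Finset.sum_apply, Measure.smul_apply,
        smul_eq_mul]
      rw [ENNReal.toReal_sum fun j _ =>
        ENNReal.mul_ne_top ENNReal.ofReal_ne_top (measure_ne_top _ _)]
      refine Finset.sum_congr rfl fun j _ => ?_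
      rw [ENNReal.toReal_mul, ENNReal.toReal_ofReal', ← (hμ j).measureReal_box (hC j) u v]
      rfl
    -- the distribution functions of both sides differ by the linear combination `hg`
    have heq : ∑ j ∈ s, ENNReal.ofReal (g j) • μ j = ∑ j ∈ s, ENNReal.ofReal (-g j) • μ j := by
      refine ext_of_squareCdf fun u v => ?_
      rw [hreal, hreal, ← sub_eq_zero, ← Finset.sum_sub_distrib]
      have := DFunLike.congr_fun hg (u, v)
      simp only [ContinuousMap.coe_sum, ContinuousMap.coe_smul, Finset.sum_apply, Pi.smul_apply,
        smul_eq_mul, ContinuousMap.zero_apply] at this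
      refine Eq.trans ?_ this
      refine Finset.sum_congr rfl fun j _ => ?_
      rw [← sub_mul]
      congr 1
      exact posPart_sub_negPart (g j)
    have hle : ENNReal.ofReal (g i) • μ i ≤ ∑ j ∈ s, ENNReal.ofReal (-g j) • μ j := by
      rw [← heq]
      exact Finset.single_le_sum (f := fun j => ENNReal.ofReal (g j) • μ j)
        (fun _ _ => Measure.zero_le _) hi
    have hsing : (μ i).MutuallySingular (∑ j ∈ s, ENNReal.ofReal (-g j) • μ j) := by
      refine Finset.sum_induction _ (fun ν => (μ i).MutuallySingular ν)
        (fun _ _ => Measure.MutuallySingular.add_right) Measure.MutuallySingular.zero_right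
        fun j _ => ?_
      by_cases hij : i = j
      · subst hij
        rw [ENNReal.ofReal_of_nonpos (by linarith), zero_smul]
        exact Measure.MutuallySingular.zero_right
      · exact ((h j i (Ne.symm hij)).smul _).symm
    have hac : μ i ≪ ENNReal.ofReal (g i) • μ i :=
      Measure.absolutelyContinuous_smul (by simpa using hpos)
    exact IsProbabilityMeasure.ne_zero (μ i)
      (Measure.eq_zero_of_absolutelyContinuous_of_mutuallySingular
        (hac.trans (Measure.absolutelyContinuous_of_le hle)) hsing)
  rw [linearIndependent_iff']
  intro s g hg i hi
  refine le_antisymm (key s g hg i hi) ?_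
  have := key s (-g) (by simp [neg_smul, Finset.sum_neg_distrib, hg]) i hi
  simpa using this

theorem support_smul_of_ne_zero {Y : Type*} [TopologicalSpace Y] [MeasurableSpace Y]
    (μ : Measure Y) {c : ℝ≥0∞} (hc : c ≠ 0) : (c • μ).support = μ.support := by
  ext x
  simp only [Measure.mem_support_iff_forall, Measure.smul_apply, smul_eq_mul, pos_iff_ne_zero,
    mul_ne_zero_iff, hc, ne_eq, not_false_eq_true, true_and]

/-- A convex combination with positive weights of measures with the support `K` has the
support `K`. -/
theorem convex_copulas_with_support (K : Set (I × I)) :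
    Convex ℝ {C : C(I × I, ℝ) | IsCopula C ∧ ∃ μ, IsCopulaMeasure C μ ∧ μ.support = K} := by
  rw [convex_iff_forall_pos]
  rintro C ⟨hC, μ, hμ, hμK⟩ D ⟨hD, ν, hν, hνK⟩ a b ha hb hab
  have := hμ.isProbabilityMeasure
  have := hν.isProbabilityMeasure
  refine ⟨⟨fun p => ?_, fun v => ?_, fun u => ?_, fun v => ?_, fun u => ?_, ?_⟩,
    ENNReal.ofReal a • μ + ENNReal.ofReal b • ν, ?_, ?_⟩
  · exact convex_Icc (0 : ℝ) 1 (hC.mem_Icc p) (hD.mem_Icc p) ha.le hb.le hab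
  · simp [hC.zero_left, hD.zero_left]
  · simp [hC.zero_right, hD.zero_right]
  · simp [hC.one_left, hD.one_left, ← add_mul, hab]
  · simp [hC.one_right, hD.one_right, ← add_mul, hab]
  · intro a₁ b₁ a₂ b₂ h₁ h₂
    have hC' := mul_nonneg ha.le (hC.volume_nonneg a₁ b₁ a₂ b₂ h₁ h₂)
    have hD' := mul_nonneg hb.le (hD.volume_nonneg a₁ b₁ a₂ b₂ h₁ h₂)
    simp only [ContinuousMap.coe_add, ContinuousMap.coe_smul, Pi.add_apply, Pi.smul_apply,
      smul_eq_mul]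
    linarith
  · have : IsProbabilityMeasure (ENNReal.ofReal a • μ + ENNReal.ofReal b • ν) :=
      ⟨by simp [← ENNReal.ofReal_add ha.le hb.le, hab]⟩
    have := μ.smul_finite (c := ENNReal.ofReal a) ENNReal.ofReal_ne_top
    have := ν.smul_finite (c := ENNReal.ofReal b) ENNReal.ofReal_ne_top
    refine isCopulaMeasure_of_measureReal_box fun u v => ?_
    rw [measureReal_add_apply, measureReal_ennreal_smul_apply, measureReal_ennreal_smul_apply,
      hμ.measureReal_box hC, hν.measureReal_box hD, ENNReal.toReal_ofReal ha.le,
      ENNReal.toReal_ofReal hb.le]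
    rfl
  · rw [Measure.support_add, support_smul_of_ne_zero _ (by simpa using ha),
      support_smul_of_ne_zero _ (by simpa using hb), hμK, hνK, union_self]

/-- A continuous function is determined by its values on a countable dense set. -/
theorem mk_continuousMap_square : Cardinal.mk C(I × I, ℝ) = Cardinal.continuum := by
  apply le_antisymm
  · obtain ⟨S, hS, hd⟩ := TopologicalSpace.exists_countable_dense (I × I)
    have hinj : Function.Injective fun (f : C(I × I, ℝ)) (x : S) => f x := by
      intro f g hfg
      refine DFunLike.coe_injective (Continuous.ext_on hd f.continuous g.continuous fun x hx => ?_)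
      exact congrFun hfg ⟨x, hx⟩
    refine (Cardinal.mk_le_of_injective hinj).trans ?_
    rw [← Cardinal.power_def, Cardinal.mk_real]
    calc Cardinal.continuum ^ Cardinal.mk S ≤ Cardinal.continuum ^ Cardinal.aleph0 :=
          Cardinal.power_le_power_left Cardinal.continuum_ne_zero (Cardinal.mk_le_aleph0_iff.2 hS)
      _ = Cardinal.continuum := Cardinal.continuum_power_aleph0
  · rw [← Cardinal.mk_real]
    refine Cardinal.mk_le_of_injective (f := fun c : ℝ => ContinuousMap.const (I × I) c) ?_
    intro a b hab
    exact DFunLike.congr_fun hab (0, 0)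

end Copula

/-! ### The subdivision of the unit interval -/

section Grid

/-- The lengths of the three intervals into which the unit interval is divided. -/
def gridWidth (r : ℝ) : Fin 3 → ℝ := ![r, 1 - 2 * r, r]

/-- The left ends of the three intervals into which the unit interval is divided. -/
def gridStart (r : ℝ) : Fin 3 → ℝ := ![0, r, 1 - r]

/-- The increasing affine map of the unit interval onto the `j`-th interval of the subdivision. -/
noncomputable def gridMap (r : ℝ) (j : Fin 3) (x : I) : I :=
  clampUnit (gridStart r j + gridWidth r j * x)

/-- The inverse of `gridMap r j`, with constant values to the left and to the right of the `j`-th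
interval. -/
noncomputable def gridPull (r : ℝ) (j : Fin 3) (u : I) : I :=
  clampUnit ((u - gridStart r j) / gridWidth r j)

variable {r : ℝ}

theorem gridWidth_rev (r : ℝ) (j : Fin 3) : gridWidth r j.rev = gridWidth r j := by
  fin_cases j <;> rfl

theorem gridWidth_pos (hr : r ∈ Ioo (0 : ℝ) (1 / 2)) (j : Fin 3) : 0 < gridWidth r j := by
  obtain ⟨h0, h1⟩ := hr
  fin_cases j <;> simp [gridWidth] <;> linarith

theorem gridWidth_le (hr : r ∈ Ioo (0 : ℝ) (1 / 2)) (j : Fin 3) : gridWidth r j ≤ 1 - r := by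
  obtain ⟨h0, h1⟩ := hr
  fin_cases j <;> simp [gridWidth] <;> linarith

theorem coe_clampUnit_of_mem {x : ℝ} (hx : x ∈ Icc (0 : ℝ) 1) : (clampUnit x : ℝ) = x := by
  rw [clampUnit, projIcc_of_mem _ hx]

theorem clampUnit_eq_zero_or_one {x : ℝ} (hx : x < 0 ∨ 1 ≤ x) :
    clampUnit x = 0 ∨ clampUnit x = 1 := by
  rcases hx with hx | hx
  · exact Or.inl (projIcc_of_le_left _ hx.le)
  · exact Or.inr (projIcc_of_right_le _ hx)

theorem coe_gridMap (hr : r ∈ Ioo (0 : ℝ) (1 / 2)) (j : Fin 3) (x : I) :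
    (gridMap r j x : ℝ) = gridStart r j + gridWidth r j * x := by
  refine coe_clampUnit_of_mem ?_
  obtain ⟨h0, h1⟩ := hr
  obtain ⟨x, hx0, hx1⟩ := x
  fin_cases j <;> simp [gridWidth, gridStart] <;> constructor <;> nlinarith

theorem dist_gridMap (hr : r ∈ Ioo (0 : ℝ) (1 / 2)) (j : Fin 3) (x y : I) :
    dist (gridMap r j x) (gridMap r j y) = gridWidth r j * dist x y := by
  rw [Subtype.dist_eq, Subtype.dist_eq, coe_gridMap hr, coe_gridMap hr, Real.dist_eq, Real.dist_eq,
    ← abs_of_pos (gridWidth_pos hr j), ← abs_mul, abs_of_pos (gridWidth_pos hr j)]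
  congr 1
  ring

theorem gridMap_injective (hr : r ∈ Ioo (0 : ℝ) (1 / 2)) (j : Fin 3) :
    Function.Injective (gridMap r j) := by
  intro x y h
  have := dist_gridMap hr j x y
  rw [h, dist_self, zero_eq_mul] at this
  exact dist_eq_zero.1 (this.resolve_left (gridWidth_pos hr j).ne')

theorem measurable_gridMap (hr : r ∈ Ioo (0 : ℝ) (1 / 2)) (j : Fin 3) : Measurable (gridMap r j) :=
  (LipschitzWith.of_dist_le' fun x y => (dist_gridMap hr j x y).le).continuous.measurable

/-- Different intervals of the subdivision meet at most in the points `r` and `1 - r`. -/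
theorem gridMap_eq_gridMap (hr : r ∈ Ioo (0 : ℝ) (1 / 2)) {j k : Fin 3} (hjk : j ≠ k) {x y : I}
    (h : gridMap r j x = gridMap r k y) :
    (gridMap r j x : ℝ) = r ∨ (gridMap r j x : ℝ) = 1 - r := by
  have h' : gridStart r j + gridWidth r j * x = gridStart r k + gridWidth r k * y := by
    rw [← coe_gridMap hr, ← coe_gridMap hr, h]
  rw [coe_gridMap hr]
  obtain ⟨h0, h1⟩ := hr
  obtain ⟨x, hx0, hx1⟩ := x
  obtain ⟨y, hy0, hy1⟩ := y
  have e0 : gridWidth r 0 = r := rfl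
  have e1 : gridWidth r 1 = 1 - 2 * r := rfl
  have e2 : gridWidth r 2 = r := rfl
  have f0 : gridStart r 0 = 0 := rfl
  have f1 : gridStart r 1 = r := rfl
  have f2 : gridStart r 2 = 1 - r := rfl
  fin_cases j <;> fin_cases k <;> first | exact absurd rfl hjk | skip
  all_goals
    simp only [Fin.zero_eta, Fin.mk_one, Fin.reduceFinMk, e0, e1, e2, f0, f1, f2] at h' ⊢
  · exact Or.inl (by nlinarith)
  · exfalso; nlinarith
  · exact Or.inl (by nlinarith)
  · exact Or.inr (by nlinarith)
  · exfalso; nlinarith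
  · exact Or.inr (by nlinarith)

/-- A point lies in only one interval of the subdivision, if these are taken to be half-open. -/
theorem exists_forall_ne_gridPull (hr : r ∈ Ioo (0 : ℝ) (1 / 2)) (u : I) : ∃ j, ∀ k, k ≠ j →
    ((u : ℝ) - gridStart r k) / gridWidth r k < 0 ∨
      1 ≤ ((u : ℝ) - gridStart r k) / gridWidth r k := by
  have hw := gridWidth_pos hr
  obtain ⟨h0, h1⟩ := hr
  have e0 : gridWidth r 0 = r := rfl
  have e1 : gridWidth r 1 = 1 - 2 * r := rfl
  have e2 : gridWidth r 2 = r := rfl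
  have f0 : gridStart r 0 = 0 := rfl
  have f1 : gridStart r 1 = r := rfl
  have f2 : gridStart r 2 = 1 - r := rfl
  have key : ∃ j, ∀ k, k ≠ j → (u : ℝ) - gridStart r k < 0 ∨ gridWidth r k ≤ u - gridStart r k := by
    rcases lt_or_ge (u : ℝ) r with h | h
    · refine ⟨0, fun k hk => ?_⟩
      fin_cases k
      · exact absurd rfl hk
      · exact Or.inl (by simp only [Fin.mk_one, f1]; linarith)
      · exact Or.inl (by simp only [Fin.reduceFinMk, f2]; linarith)
    · rcases lt_or_ge (u : ℝ) (1 - r) with h' | h'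
      · refine ⟨1, fun k hk => ?_⟩
        fin_cases k
        · exact Or.inr (by simp only [Fin.zero_eta, f0, e0]; linarith)
        · exact absurd rfl hk
        · exact Or.inl (by simp only [Fin.reduceFinMk, f2]; linarith)
      · refine ⟨2, fun k hk => ?_⟩
        fin_cases k
        · exact Or.inr (by simp only [Fin.zero_eta, f0, e0]; linarith)
        · exact Or.inr (by simp only [Fin.mk_one, f1, e1]; linarith)
        · exact absurd rfl hk
  obtain ⟨j, hj⟩ := key
  exact ⟨j, fun k hk => (hj k hk).imp (fun h => div_neg_of_neg_of_pos h (hw k))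
    fun h => (one_le_div (hw k)).2 h⟩

theorem gridMap_le_iff (hr : r ∈ Ioo (0 : ℝ) (1 / 2)) (j : Fin 3) (x u : I) :
    gridMap r j x ≤ u ↔ (x : ℝ) ≤ ((u : ℝ) - gridStart r j) / gridWidth r j := by
  rw [← Subtype.coe_le_coe, coe_gridMap hr, le_div_iff₀' (gridWidth_pos hr j), le_sub_iff_add_le']

theorem gridMap_le_iff_le_gridPull (hr : r ∈ Ioo (0 : ℝ) (1 / 2)) (j : Fin 3) {x : I} (hx : x ≠ 0)
    (u : I) : gridMap r j x ≤ u ↔ x ≤ gridPull r j u := by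
  have hx0 : 0 < (x : ℝ) := lt_of_le_of_ne x.2.1 fun h => hx (Subtype.ext h.symm)
  rw [gridMap_le_iff hr, ← Subtype.coe_le_coe, gridPull, clampUnit, coe_projIcc, le_max_iff,
    le_min_iff]
  constructor
  · exact fun h => Or.inr ⟨x.2.2, h⟩
  · rintro (h | h)
    · exact absurd h (not_le.2 hx0)
    · exact h.2

theorem sum_gridWidth_mul_gridPull (hr : r ∈ Ioo (0 : ℝ) (1 / 2)) (u : I) :
    ∑ j, gridWidth r j * gridPull r j u = u := by
  obtain ⟨h0, h1⟩ := hr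
  have h2 : 0 < 1 - 2 * r := by linarith
  have hu := u.2
  have hmul : ∀ {w x : ℝ}, 0 < w → w * max 0 (min 1 (x / w)) = max 0 (min w x) := by
    intro w x hw
    rw [mul_max_of_nonneg _ _ hw.le, mul_min_of_nonneg _ _ hw.le, mul_zero, mul_one,
      mul_div_cancel₀ _ hw.ne']
  have e0 : gridWidth r 0 = r := rfl
  have e1 : gridWidth r 1 = 1 - 2 * r := rfl
  have e2 : gridWidth r 2 = r := rfl
  have f0 : gridStart r 0 = 0 := rfl
  have f1 : gridStart r 1 = r := rfl
  have f2 : gridStart r 2 = 1 - r := rfl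
  simp only [Fin.sum_univ_three, gridPull, clampUnit, coe_projIcc, e0, e1, e2, f0, f1, f2,
    hmul h0, hmul h2]
  rcases le_total (u : ℝ) r with h | h <;> rcases le_total (u : ℝ) (1 - r) with h' | h'
  · rw [min_eq_right (by linarith), max_eq_right (by linarith [hu.1]), min_eq_right (by linarith),
      max_eq_left (by linarith), min_eq_right (by linarith), max_eq_left (by linarith)]
    ring
  · linarith
  · rw [min_eq_left (by linarith), max_eq_right (by linarith [hu.1]), min_eq_right (by linarith),
      max_eq_right (by linarith), min_eq_right (by linarith), max_eq_left (by linarith)]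
    ring
  · rw [min_eq_left (by linarith), max_eq_right (by linarith [hu.1]), min_eq_left (by linarith),
      max_eq_right (by linarith), min_eq_right (by linarith [hu.2]), max_eq_right (by linarith)]
    ring

theorem sum_gridWidth_smul_map_apply (hr : r ∈ Ioo (0 : ℝ) (1 / 2)) (ν : Measure I) {S : Set I}
    (hS : MeasurableSet S) : (∑ j, ENNReal.ofReal (gridWidth r j) • ν.map (gridMap r j)) S
      = ∑ j, ENNReal.ofReal (gridWidth r j) * ν (gridMap r j ⁻¹' S) := by
  simp only [Measure.coe_finsetSum, Finset.sum_apply, Measure.smul_apply, smul_eq_mul]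
  exact Finset.sum_congr rfl fun j _ => by rw [Measure.map_apply (measurable_gridMap hr j) hS]

/-- Lebesgue measure is self-similar for every subdivision of the unit interval. -/
theorem sum_gridWidth_smul_map_volume (hr : r ∈ Ioo (0 : ℝ) (1 / 2)) :
    ∑ j, ENNReal.ofReal (gridWidth r j) • (volume : Measure I).map (gridMap r j) = volume := by
  refine (Measure.ext_of_Iic _ _ fun u => ?_).symm
  have hpre : ∀ j, (volume : Measure I) (gridMap r j ⁻¹' Iic u)
      = ENNReal.ofReal (gridPull r j u) := by
    intro j
    rw [← unitInterval.volume_Iic]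
    refine measure_congr ?_
    filter_upwards [compl_mem_ae_iff.2 (measure_singleton (0 : I))] with x hx
    exact propext (gridMap_le_iff_le_gridPull hr j hx u)
  rw [sum_gridWidth_smul_map_apply hr _ measurableSet_Iic, unitInterval.volume_Iic]
  simp only [hpre]
  conv_lhs => rw [← sum_gridWidth_mul_gridPull hr u]
  rw [ENNReal.ofReal_sum_of_nonneg fun j _ =>
    mul_nonneg (gridWidth_pos hr j).le (gridPull r j u).2.1]
  exact Finset.sum_congr rfl fun j _ => ENNReal.ofReal_mul (gridWidth_pos hr j).le

/-- Lebesgue measure is the only self-similar probability measure: at each point, the difference of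
the distribution functions is zero or a multiple, by a factor of at most `1 - r`, of its value at
another point. -/
theorem eq_volume_of_selfSimilar (hr : r ∈ Ioo (0 : ℝ) (1 / 2)) {ν : Measure I}
    [IsProbabilityMeasure ν]
    (hν : ∑ j, ENNReal.ofReal (gridWidth r j) • ν.map (gridMap r j) = ν) : ν = volume := by
  have hr1 : 0 ≤ 1 - r := by linarith [hr.2]
  have hreal : ∀ {κ : Measure I} [IsProbabilityMeasure κ],
      ∑ j, ENNReal.ofReal (gridWidth r j) • κ.map (gridMap r j) = κ → ∀ u : I,
        κ.real (Iic u) = ∑ j, gridWidth r j * κ.real (gridMap r j ⁻¹' Iic u) := by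
    intro κ _ hκ u
    conv_lhs => rw [← hκ]
    rw [Measure.real, sum_gridWidth_smul_map_apply hr _ measurableSet_Iic,
      ENNReal.toReal_sum fun j _ => ENNReal.mul_ne_top ENNReal.ofReal_ne_top (measure_ne_top _ _)]
    refine Finset.sum_congr rfl fun j _ => ?_
    rw [ENNReal.toReal_mul, ENNReal.toReal_ofReal (gridWidth_pos hr j).le]
    rfl
  have hempty : ∀ (j : Fin 3) (u : I), ((u : ℝ) - gridStart r j) / gridWidth r j < 0 →
      gridMap r j ⁻¹' Iic u = ∅ := fun j u h =>
    eq_empty_of_forall_notMem fun x hx => absurd ((gridMap_le_iff hr j x u).1 hx)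
      (not_le.2 (h.trans_le x.2.1))
  have huniv : ∀ (j : Fin 3) (u : I), 1 ≤ ((u : ℝ) - gridStart r j) / gridWidth r j →
      gridMap r j ⁻¹' Iic u = univ := fun j u h =>
    eq_univ_of_forall fun x => (gridMap_le_iff hr j x u).2 (x.2.2.trans h)
  have hbound : ∀ (n : ℕ) (u : I), |ν.real (Iic u) - (volume : Measure I).real (Iic u)|
      ≤ (1 - r) ^ n := by
    intro n
    induction n with
    | zero =>
      intro u
      rw [pow_zero, abs_le]
      constructor <;> linarith [measureReal_nonneg (μ := ν) (s := Iic u),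
        measureReal_le_one (μ := ν) (s := Iic u),
        measureReal_nonneg (μ := (volume : Measure I)) (s := Iic u),
        measureReal_le_one (μ := (volume : Measure I)) (s := Iic u)]
    | succ n ih =>
      intro u
      obtain ⟨j, hj⟩ := exists_forall_ne_gridPull hr u
      have hone : |ν.real (gridMap r j ⁻¹' Iic u) -
          (volume : Measure I).real (gridMap r j ⁻¹' Iic u)|
          ≤ (1 - r) ^ n := by
        rcases lt_or_ge (((u : ℝ) - gridStart r j) / gridWidth r j) 0 with h | h
        · simpa [hempty j u h] using pow_nonneg hr1 n
        rcases le_or_gt 1 (((u : ℝ) - gridStart r j) / gridWidth r j) with h' | h'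
        · simpa [huniv j u h'] using pow_nonneg hr1 n
        · have : gridMap r j ⁻¹' Iic u =
              Iic ⟨((u : ℝ) - gridStart r j) / gridWidth r j, h, h'.le⟩ :=
            Set.ext fun x => gridMap_le_iff hr j x u
          rw [this]
          exact ih _
      rw [hreal hν, hreal (sum_gridWidth_smul_map_volume hr), ← Finset.sum_sub_distrib,
        Finset.sum_eq_single j, ← mul_sub, abs_mul, abs_of_pos (gridWidth_pos hr j), pow_succ']
      · exact mul_le_mul (gridWidth_le hr j) hone (abs_nonneg _) hr1
      · intro k _ hk
        rcases hj k hk with h | h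
        · simp [hempty k u h]
        · simp [huniv k u h]
      · simp
  refine Measure.ext_of_Iic _ _ fun u => (measureReal_eq_measureReal_iff).1 ?_
  have hlim := tendsto_pow_atTop_nhds_zero_of_lt_one hr1 (by linarith [hr.1])
  have := ge_of_tendsto' hlim fun n => hbound n u
  exact sub_eq_zero.1 (abs_eq_zero.1 (le_antisymm this (abs_nonneg _)))

end Grid

/-! ### Balls in the unit square -/

section Balls

theorem volume_ball_unitInterval_le (x : I) (δ : ℝ) :
    (volume : Measure I) (Metric.ball x δ) ≤ ENNReal.ofReal (2 * δ) := by
  rw [unitInterval.volume_apply, ← Real.volume_ball (x : ℝ) δ]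
  refine measure_mono ?_
  rintro _ ⟨y, hy, rfl⟩
  exact hy

theorem le_volume_ball_unitInterval (x : I) {δ : ℝ} (hδ : δ ∈ Ioc (0 : ℝ) 1) :
    ENNReal.ofReal (δ / 2) ≤ (volume : Measure I) (Metric.ball x δ) := by
  obtain ⟨h0, h1⟩ := hδ
  obtain ⟨x, hx0, hx1⟩ := x
  rcases le_total x (1 / 2) with h | h
  · have hy : x + δ / 2 ∈ I := ⟨by linarith, by linarith⟩
    calc ENNReal.ofReal (δ / 2) = volume (Icc (⟨x, hx0, hx1⟩ : I) ⟨x + δ / 2, hy⟩) := by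
          rw [unitInterval.volume_Icc]
          congr 1
          ring
      _ ≤ _ := measure_mono fun z hz => by
          have hz1 : x ≤ z := hz.1
          have hz2 : (z : ℝ) ≤ x + δ / 2 := hz.2
          rw [Metric.mem_ball, Subtype.dist_eq, Real.dist_eq, abs_lt]
          constructor <;> simp only <;> linarith
  · have hy : x - δ / 2 ∈ I := ⟨by linarith, by linarith⟩
    calc ENNReal.ofReal (δ / 2) = volume (Icc (⟨x - δ / 2, hy⟩ : I) ⟨x, hx0, hx1⟩) := by
          rw [unitInterval.volume_Icc]
          congr 1
          ring
      _ ≤ _ := measure_mono fun z hz => by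
          have hz1 : x - δ / 2 ≤ z := hz.1
          have hz2 : (z : ℝ) ≤ x := hz.2
          rw [Metric.mem_ball, Subtype.dist_eq, Real.dist_eq, abs_lt]
          constructor <;> simp only <;> linarith

theorem volume_ball_square (p : I × I) (δ : ℝ) : (volume : Measure (I × I)) (Metric.ball p δ)
    = (volume : Measure I) (Metric.ball p.1 δ) * (volume : Measure I) (Metric.ball p.2 δ) := by
  rw [← ball_prod_same, Measure.volume_eq_prod, Measure.prod_prod]

end Balls

/-! ### The five similarities of the square -/

section Cells

/-- The positions of the nonzero entries of `transMatrix r a`: the corners and the center. They are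
the positions with both indices or none equal to `1`. -/
abbrev CellIndex : Type := {p : Fin 3 × Fin 3 // p.1 = 1 ↔ p.2 = 1}

/-- The similarity of the unit square onto the cell of an entry. The rows of a matrix are numbered
from top to bottom, hence the reversal of the row index. -/
noncomputable def squareMap (r : ℝ) (x : CellIndex) : I × I → I × I :=
  Prod.map (gridMap r x.1.2) (gridMap r x.1.1.rev)

variable {r a : ℝ}

theorem sum_cellIndex {M : Type*} [AddCommMonoid M] (F : Fin 3 → Fin 3 → M)
    (h : ∀ i j, ¬(i = 1 ↔ j = 1) → F i j = 0) :
    ∑ x : CellIndex, F x.1.1 x.1.2 = ∑ i, ∑ j, F i j := by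
  rw [← Fintype.sum_prod_type', ← Finset.sum_subtype
    (Finset.univ.filter fun p : Fin 3 × Fin 3 => p.1 = 1 ↔ p.2 = 1) (by simp)
    (fun p : Fin 3 × Fin 3 => F p.1 p.2)]
  exact Finset.sum_filter_of_ne fun p _ hp => not_not.1 fun h' => hp (h _ _ h')

theorem transMatrix_ne_zero_iff (ha : a ∈ Ioo (0 : ℝ) r) (hr : r ∈ Ioo (0 : ℝ) (1 / 2))
    (i j : Fin 3) : transMatrix r a i j ≠ 0 ↔ (i = 1 ↔ j = 1) := by
  obtain ⟨h0, h1⟩ := ha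
  obtain ⟨h2, h3⟩ := hr
  have h4 : r - a ≠ 0 := by linarith
  have h5 : 1 - 2 * r ≠ 0 := by linarith
  fin_cases i <;> fin_cases j <;> simp [transMatrix, h0.ne', h4, h5]

theorem transMatrix_nonneg (ha : a ∈ Ioo (0 : ℝ) r) (hr : r ∈ Ioo (0 : ℝ) (1 / 2))
    (i j : Fin 3) : 0 ≤ transMatrix r a i j := by
  obtain ⟨h0, h1⟩ := ha
  obtain ⟨h2, h3⟩ := hr
  fin_cases i <;> fin_cases j <;> simp [transMatrix] <;> linarith

theorem transMatrix_le (ha : a ∈ Ioo (0 : ℝ) r) (hr : r ∈ Ioo (0 : ℝ) (1 / 2))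
    (i j : Fin 3) : transMatrix r a i j ≤ 1 - r := by
  obtain ⟨h0, h1⟩ := ha
  obtain ⟨h2, h3⟩ := hr
  fin_cases i <;> fin_cases j <;> simp [transMatrix] <;> linarith

theorem colWidth_transMatrix (r a : ℝ) (j : Fin 3) :
    colWidth (transMatrix r a) j = gridWidth r j := by
  fin_cases j <;> simp [colWidth, transMatrix, gridWidth, Fin.sum_univ_three]

theorem rowHeight_transMatrix (r a : ℝ) (i : Fin 3) :
    rowHeight (transMatrix r a) i = gridWidth r i.rev := by
  rw [gridWidth_rev]
  fin_cases i <;> simp [rowHeight, transMatrix, gridWidth, Fin.sum_univ_three]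

theorem colStart_transMatrix (r a : ℝ) (j : Fin 3) :
    colStart (transMatrix r a) j = gridStart r j := by
  have h0 : Finset.Iio (0 : Fin 3) = ∅ := rfl
  have h1 : Finset.Iio (1 : Fin 3) = {0} := rfl
  have h2 : Finset.Iio (2 : Fin 3) = {0, 1} := rfl
  simp only [colStart, colWidth_transMatrix]
  fin_cases j <;> simp [gridStart, h0, h1, h2, gridWidth]
  ring

theorem rowStart_transMatrix (r a : ℝ) (i : Fin 3) :
    rowStart (transMatrix r a) i = gridStart r i.rev := by
  have h0 : Finset.Ioi (0 : Fin 3) = {1, 2} := rfl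
  have h1 : Finset.Ioi (1 : Fin 3) = {2} := rfl
  have h2 : Finset.Ioi (2 : Fin 3) = ∅ := rfl
  simp only [rowStart, rowHeight_transMatrix, gridWidth_rev]
  fin_cases i <;> simp [gridStart, h0, h1, h2, gridWidth, Fin.rev]
  ring

theorem cellMap_transMatrix (r a : ℝ) (i j : Fin 3) :
    cellMap (transMatrix r a) i j = Prod.map (gridMap r j) (gridMap r i.rev) := by
  funext p
  simp only [cellMap, colStart_transMatrix, colWidth_transMatrix, rowStart_transMatrix,
    rowHeight_transMatrix]
  rfl

theorem transformCopula_transMatrix (r a : ℝ) (C : I × I → ℝ) (p : I × I) :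
    transformCopula (transMatrix r a) C p = ∑ i, ∑ j, transMatrix r a i j *
      C (gridPull r j p.1, gridPull r i.rev p.2) := by
  simp only [transformCopula, colStart_transMatrix, colWidth_transMatrix, rowStart_transMatrix,
    rowHeight_transMatrix]
  rfl

theorem sum_transMatrix (r a : ℝ) : ∑ i, ∑ j, transMatrix r a i j = 1 := by
  simp [transMatrix, Fin.sum_univ_three]
  ring

theorem isTransformationMatrix_transMatrix (ha : a ∈ Ioo (0 : ℝ) r)
    (hr : r ∈ Ioo (0 : ℝ) (1 / 2)) : IsTransformationMatrix (transMatrix r a) where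
  nonneg := transMatrix_nonneg ha hr
  sum_eq_one := sum_transMatrix r a
  row_ne_zero i := ⟨i, (transMatrix_ne_zero_iff ha hr i i).2 Iff.rfl⟩
  col_ne_zero j := ⟨j, (transMatrix_ne_zero_iff ha hr j j).2 Iff.rfl⟩

theorem gridWidth_row_eq_col (r : ℝ) (x : CellIndex) :
    gridWidth r x.1.1.rev = gridWidth r x.1.2 := by
  rw [gridWidth_rev]
  obtain ⟨⟨i, j⟩, h⟩ := x
  fin_cases i <;> fin_cases j <;> simp [gridWidth] at h ⊢

theorem dist_squareMap (hr : r ∈ Ioo (0 : ℝ) (1 / 2)) (x : CellIndex) (p q : I × I) :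
    dist (squareMap r x p) (squareMap r x q) = gridWidth r x.1.2 * dist p q := by
  rw [Prod.dist_eq, Prod.dist_eq, squareMap, Prod.map_fst, Prod.map_fst, Prod.map_snd, Prod.map_snd,
    dist_gridMap hr, dist_gridMap hr, gridWidth_row_eq_col,
    mul_max_of_nonneg _ _ (gridWidth_pos hr _).le]

theorem measurable_squareMap (hr : r ∈ Ioo (0 : ℝ) (1 / 2)) (x : CellIndex) :
    Measurable (squareMap r x) :=
  (measurable_gridMap hr _).prodMap (measurable_gridMap hr _)

theorem squareMap_injective (hr : r ∈ Ioo (0 : ℝ) (1 / 2)) (x : CellIndex) :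
    Function.Injective (squareMap r x) :=
  (gridMap_injective hr _).prodMap (gridMap_injective hr _)

/-- The points of the square on the grid lines that separate the cells. -/
def gridLines (r : ℝ) : Set (I × I) :=
  Prod.fst ⁻¹' {x : I | (x : ℝ) = r ∨ (x : ℝ) = 1 - r} ∪
    Prod.snd ⁻¹' {x : I | (x : ℝ) = r ∨ (x : ℝ) = 1 - r}

theorem countable_gridPoints (r : ℝ) : {x : I | (x : ℝ) = r ∨ (x : ℝ) = 1 - r}.Countable :=
  ((Set.toFinite {r, 1 - r}).preimage Subtype.val_injective.injOn).countable

theorem measurableSet_gridLines (r : ℝ) : MeasurableSet (gridLines r) :=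
  (measurable_fst (countable_gridPoints r).measurableSet).union
    (measurable_snd (countable_gridPoints r).measurableSet)

theorem measure_gridLines {μ : Measure (I × I)} (h1 : μ.map Prod.fst = volume)
    (h2 : μ.map Prod.snd = volume) (r : ℝ) : μ (gridLines r) = 0 := by
  have hm := (countable_gridPoints r).measurableSet
  refine measure_union_null ?_ ?_
  · rw [← Measure.map_apply measurable_fst hm, h1]
    exact (countable_gridPoints r).measure_zero _
  · rw [← Measure.map_apply measurable_snd hm, h2]
    exact (countable_gridPoints r).measure_zero _

theorem range_squareMap_inter_subset (hr : r ∈ Ioo (0 : ℝ) (1 / 2)) (x y : CellIndex)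
    (hxy : x ≠ y) : range (squareMap r x) ∩ range (squareMap r y) ⊆ gridLines r := by
  rintro _ ⟨⟨p, rfl⟩, ⟨q, hq⟩⟩
  by_cases h : x.1.2 = y.1.2
  · have h' : x.1.1.rev ≠ y.1.1.rev := fun h' =>
      hxy (Subtype.ext (Prod.ext (Fin.rev_injective h') h))
    exact Or.inr (gridMap_eq_gridMap hr h' (congrArg Prod.snd hq).symm)
  · exact Or.inl (gridMap_eq_gridMap hr h (congrArg Prod.fst hq).symm)

/-- The equation for the similarity dimension, as a sum over the five similarities. -/
theorem sum_gridWidth_rpow (r s : ℝ) :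
    ∑ x : CellIndex, gridWidth r x.1.2 ^ s = 4 * r ^ s + (1 - 2 * r) ^ s := by
  have := sum_cellIndex (fun i j => if i = 1 ↔ j = 1 then gridWidth r j ^ s else 0)
    fun i j h => if_neg h
  rw [Finset.sum_congr rfl fun (x : CellIndex) _ => if_pos x.2] at this
  rw [this]
  simp [Fin.sum_univ_three, gridWidth]
  ring

/-- The area of the square is subinvariant under the five similarities: it is invariant under the
maps onto all nine cells. -/
theorem sum_smul_map_volume_le (hr : r ∈ Ioo (0 : ℝ) (1 / 2)) :
    ∑ x : CellIndex, ENNReal.ofReal (gridWidth r x.1.2 ^ (2 : ℝ)) •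
      (volume : Measure (I × I)).map (squareMap r x) ≤ volume := by
  have hall : (volume : Measure (I × I)) = ∑ i : Fin 3, ∑ j : Fin 3,
      (ENNReal.ofReal (gridWidth r j) * ENNReal.ofReal (gridWidth r i.rev)) •
        (volume : Measure (I × I)).map (Prod.map (gridMap r j) (gridMap r i.rev)) := by
    refine Measure.prod_eq fun S T hS hT => ?_
    conv_rhs => rw [← sum_gridWidth_smul_map_volume hr]
    rw [sum_gridWidth_smul_map_apply hr _ hS, sum_gridWidth_smul_map_apply hr _ hT,
      Finset.sum_mul_sum, Finset.sum_comm]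
    simp only [Measure.coe_finsetSum, Finset.sum_apply, Measure.smul_apply, smul_eq_mul]
    refine Finset.sum_congr rfl fun j _ => ?_
    refine Eq.trans (Finset.sum_congr rfl fun i _ => ?_) (Equiv.sum_comp Fin.revPerm _)
    rw [Measure.map_apply ((measurable_gridMap hr _).prodMap (measurable_gridMap hr _))
      (hS.prod hT), preimage_prod_map_prod, Measure.volume_eq_prod, Measure.prod_prod,
      Fin.revPerm_apply]
    ring
  conv_rhs => rw [hall]
  -- the sum over the five cells, with zero summands for the other four
  have hcorner := sum_cellIndex (fun i j => if i = 1 ↔ j = 1 then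
    (ENNReal.ofReal (gridWidth r j) * ENNReal.ofReal (gridWidth r i.rev)) •
      (volume : Measure (I × I)).map (Prod.map (gridMap r j) (gridMap r i.rev)) else 0)
    fun i j h => if_neg h
  calc _ = _ := Finset.sum_congr rfl fun x _ => ?_
    _ = _ := hcorner
    _ ≤ _ := Finset.sum_le_sum fun i _ => Finset.sum_le_sum fun j _ => ?_
  · rw [if_pos x.2, gridWidth_row_eq_col, ← ENNReal.ofReal_mul (gridWidth_pos hr _).le,
      Real.rpow_two, pow_two]
    rfl
  · split_ifs
    · exact le_rfl
    · exact Measure.zero_le _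

/-- The weights of the invariant measure: the nonzero entries of the matrix. -/
noncomputable def cellWeight (r a : ℝ) (x : CellIndex) : ℝ≥0∞ :=
  ENNReal.ofReal (transMatrix r a x.1.1 x.1.2)

theorem sum_cellWeight (ha : a ∈ Ioo (0 : ℝ) r) (hr : r ∈ Ioo (0 : ℝ) (1 / 2)) :
    ∑ x, cellWeight r a x = 1 := by
  have h := sum_cellIndex (transMatrix r a) fun i j h =>
    not_not.1 (mt (transMatrix_ne_zero_iff ha hr i j).1 h)
  rw [sum_transMatrix] at h
  simp only [cellWeight]
  rw [← ENNReal.ofReal_sum_of_nonneg fun x _ => transMatrix_nonneg ha hr _ _, h, ENNReal.ofReal_one]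

theorem selfSimilar_apply (ha : a ∈ Ioo (0 : ℝ) r) (hr : r ∈ Ioo (0 : ℝ) (1 / 2))
    {μ : Measure (I × I)} (hμ : μ = ∑ x, cellWeight r a x • μ.map (squareMap r x))
    {S : Set (I × I)} (hS : MeasurableSet S) :
    μ S = ∑ i, ∑ j, ENNReal.ofReal (transMatrix r a i j) *
      μ (Prod.map (gridMap r j) (gridMap r i.rev) ⁻¹' S) := by
  rw [← sum_cellIndex]
  · conv_lhs => rw [hμ]
    simp only [Measure.coe_finsetSum, Finset.sum_apply, Measure.smul_apply, smul_eq_mul]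
    refine Finset.sum_congr rfl fun x _ => ?_
    rw [Measure.map_apply (measurable_squareMap hr x) hS]
    rfl
  · intro i j h
    rw [not_not.1 (mt (transMatrix_ne_zero_iff ha hr i j).1 h), ENNReal.ofReal_zero, zero_mul]

theorem map_fst_eq_volume (ha : a ∈ Ioo (0 : ℝ) r) (hr : r ∈ Ioo (0 : ℝ) (1 / 2))
    {μ : Measure (I × I)} [IsProbabilityMeasure μ]
    (hμ : μ = ∑ x, cellWeight r a x • μ.map (squareMap r x)) : μ.map Prod.fst = volume := by
  have := Measure.isProbabilityMeasure_map (μ := μ) measurable_fst.aemeasurable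
  refine eq_volume_of_selfSimilar hr (Measure.ext fun S hS => ?_)
  rw [sum_gridWidth_smul_map_apply hr _ hS, Measure.map_apply measurable_fst hS,
    selfSimilar_apply ha hr hμ (measurable_fst hS), Finset.sum_comm]
  refine Finset.sum_congr rfl fun j _ => ?_
  rw [← colWidth_transMatrix r a, colWidth,
    ENNReal.ofReal_sum_of_nonneg fun i _ => transMatrix_nonneg ha hr i j, Finset.sum_mul,
    Measure.map_apply measurable_fst (measurable_gridMap hr j hS)]
  rfl

theorem map_snd_eq_volume (ha : a ∈ Ioo (0 : ℝ) r) (hr : r ∈ Ioo (0 : ℝ) (1 / 2))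
    {μ : Measure (I × I)} [IsProbabilityMeasure μ]
    (hμ : μ = ∑ x, cellWeight r a x • μ.map (squareMap r x)) : μ.map Prod.snd = volume := by
  have := Measure.isProbabilityMeasure_map (μ := μ) measurable_snd.aemeasurable
  refine eq_volume_of_selfSimilar hr (Measure.ext fun S hS => ?_)
  rw [sum_gridWidth_smul_map_apply hr _ hS, Measure.map_apply measurable_snd hS,
    selfSimilar_apply ha hr hμ (measurable_snd hS), ← Equiv.sum_comp Fin.revPerm]
  refine Finset.sum_congr rfl fun i _ => ?_
  rw [Fin.revPerm_apply, ← rowHeight_transMatrix r a, rowHeight,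
    ENNReal.ofReal_sum_of_nonneg fun j _ => transMatrix_nonneg ha hr i j, Finset.sum_mul,
    Measure.map_apply measurable_snd (measurable_gridMap hr _ hS)]
  rfl

/-- The distribution function of the self-similar measure is invariant. Since the margins have no
atoms, it does not matter that `gridPull` is `0` to the left of an interval, where the
preimage of `[0, u]` under `gridMap` is empty. -/
theorem transformCopula_squareCdf (ha : a ∈ Ioo (0 : ℝ) r) (hr : r ∈ Ioo (0 : ℝ) (1 / 2))
    {μ : Measure (I × I)} [IsProbabilityMeasure μ]
    (hμ : μ = ∑ x, cellWeight r a x • μ.map (squareMap r x)) :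
    transformCopula (transMatrix r a) (squareCdf μ) = squareCdf μ := by
  have h0 : ∀ᵐ x : I, x ≠ 0 := compl_mem_ae_iff.2 (measure_singleton 0)
  have hfst : ∀ᵐ p ∂μ, p.1 ≠ 0 := by
    refine ae_of_ae_map measurable_fst.aemeasurable (p := fun x => x ≠ 0) ?_
    rw [map_fst_eq_volume ha hr hμ]
    exact h0
  have hsnd : ∀ᵐ p ∂μ, p.2 ≠ 0 := by
    refine ae_of_ae_map measurable_snd.aemeasurable (p := fun x => x ≠ 0) ?_
    rw [map_snd_eq_volume ha hr hμ]
    exact h0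
  have hbox : ∀ (j k : Fin 3) (u v : I),
      μ (Prod.map (gridMap r j) (gridMap r k) ⁻¹' (Iic u ×ˢ Iic v))
      = μ (Iic (gridPull r j u) ×ˢ Iic (gridPull r k v)) := by
    intro j k u v
    refine measure_congr ?_
    filter_upwards [hfst, hsnd] with p hp1 hp2
    exact propext (and_congr (gridMap_le_iff_le_gridPull hr j hp1 u)
      (gridMap_le_iff_le_gridPull hr k hp2 v))
  funext p
  rw [transformCopula_transMatrix, squareCdf, Measure.real,
    selfSimilar_apply ha hr hμ (measurableSet_Iic.prod measurableSet_Iic)]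
  have hfin : ∀ i j, ENNReal.ofReal (transMatrix r a i j) *
      μ (Prod.map (gridMap r j) (gridMap r i.rev) ⁻¹' (Iic p.1 ×ˢ Iic p.2)) ≠ ∞ := fun i j =>
    ENNReal.mul_ne_top ENNReal.ofReal_ne_top (measure_ne_top _ _)
  rw [ENNReal.toReal_sum fun i _ => ENNReal.sum_ne_top.2 fun j _ => hfin i j]
  refine Finset.sum_congr rfl fun i _ => ?_
  rw [ENNReal.toReal_sum fun j _ => hfin i j]
  refine Finset.sum_congr rfl fun j _ => ?_
  rw [ENNReal.toReal_mul, ENNReal.toReal_ofReal (transMatrix_nonneg ha hr i j), hbox]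
  rfl

/-- Invariant copulas are unique: two copulas agree on the boundary of the square, so that at each
point only one summand of the transforms can differ, and it differs by the product of a matrix
entry, at most `1 - r`, and the difference of the copulas at another point. -/
theorem IsInvariantCopula.eq (ha : a ∈ Ioo (0 : ℝ) r) (hr : r ∈ Ioo (0 : ℝ) (1 / 2))
    {C D : I × I → ℝ} (hC : IsInvariantCopula (transMatrix r a) C)
    (hD : IsInvariantCopula (transMatrix r a) D) : C = D := by
  have hr1 : 0 ≤ 1 - r := by linarith [hr.2]
  have hbound : ∀ (n : ℕ) (p : I × I), |C p - D p| ≤ (1 - r) ^ n := by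
    intro n
    induction n with
    | zero =>
      intro p
      have h1 := hC.1.mem_Icc p
      have h2 := hD.1.mem_Icc p
      rw [pow_zero, abs_le]
      constructor <;> linarith [h1.1, h1.2, h2.1, h2.2]
    | succ n ih =>
      intro p
      obtain ⟨j, hj⟩ := exists_forall_ne_gridPull hr p.1
      obtain ⟨k, hk⟩ := exists_forall_ne_gridPull hr p.2
      rw [← hC.2, ← hD.2, transformCopula_transMatrix, transformCopula_transMatrix,
        ← Finset.sum_sub_distrib]
      simp only [← Finset.sum_sub_distrib, ← mul_sub]
      rw [Finset.sum_eq_single k.rev, Finset.sum_eq_single j, abs_mul,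
        abs_of_nonneg (transMatrix_nonneg ha hr _ _), pow_succ']
      · exact mul_le_mul (transMatrix_le ha hr _ _) (ih _) (abs_nonneg _) hr1
      · intro l _ hl
        have hl' : gridPull r l p.1 = 0 ∨ gridPull r l p.1 = 1 := clampUnit_eq_zero_or_one (hj l hl)
        rw [hC.1.apply_eq_of_left hD.1 hl', sub_self, mul_zero]
      · simp
      · intro i _ hi
        refine Finset.sum_eq_zero fun l _ => ?_
        have hi' : gridPull r i.rev p.2 = 0 ∨ gridPull r i.rev p.2 = 1 :=
          clampUnit_eq_zero_or_one (hk _ fun h => hi (by rw [← h, Fin.rev_rev]))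
        rw [hC.1.apply_eq_of_right hD.1 hi', sub_self, mul_zero]
      · simp
  funext p
  have hlim := tendsto_pow_atTop_nhds_zero_of_lt_one hr1 (by linarith [hr.1])
  have := ge_of_tendsto' hlim fun n => hbound n p
  exact sub_eq_zero.1 (abs_eq_zero.1 (le_antisymm this (abs_nonneg _)))

theorem ediam_square_le : Metric.ediam (univ : Set (I × I)) ≤ 1 := by
  have h : ∀ x y : I, edist x y ≤ 1 := fun x y => by
    rw [edist_dist, ← ENNReal.ofReal_one]
    refine ENNReal.ofReal_le_ofReal ?_
    rw [Subtype.dist_eq, Real.dist_eq, abs_le]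
    constructor <;> linarith [x.2.1, x.2.2, y.2.1, y.2.2]
  exact Metric.ediam_le fun p _ q _ => max_le (h _ _) (h _ _)

theorem dimH_attractor (hr : r ∈ Ioo (0 : ℝ) (1 / 2)) {s : ℝ} (hs : s ∈ Ioo (1 : ℝ) 2)
    (hrs : 4 * r ^ s + (1 - 2 * r) ^ s = 1) {π : (ℕ → CellIndex) → I × I}
    (hπ : IsCodingMap (squareMap r) π) : dimH (range π) = ENNReal.ofReal s := by
  have hs0 : 0 ≤ s := by linarith [hs.1]
  have hcoe : (s.toNNReal : ℝ) = s := Real.coe_toNNReal s hs0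
  have hsum : ∑ x : CellIndex, gridWidth r x.1.2 ^ s = 1 := by rw [sum_gridWidth_rpow, hrs]
  have hr1 : 0 ≤ 1 - r := by linarith [hr.2]
  refine le_antisymm ?_ ?_
  · refine dimH_range_le_of_isCodingMap hπ
      (ρ := fun x => ⟨gridWidth r x.1.2, (gridWidth_pos hr _).le⟩)
      (fun x => LipschitzWith.of_dist_le_mul fun p q => (dist_squareMap hr x p q).le)
      (c := ⟨1 - r, hr1⟩) ?_ (fun x => gridWidth_le hr _) ediam_square_le ?_
    · exact (show 1 - r < 1 by linarith [hr.1])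
    · rw [hcoe]
      apply NNReal.eq
      push_cast
      exact hsum
  · have hm : ∀ j, min r (1 - 2 * r) ≤ gridWidth r j := by
      intro j
      fin_cases j
      · exact min_le_left _ _
      · exact min_le_right _ _
      · exact min_le_left _ _
    refine hπ.le_dimH_range (ρ := fun x => gridWidth r x.1.2) (m := min r (1 - 2 * r)) (M := 1 - r)
      (d := 2) (a := 1 / 4) (b := 4) (vol := volume) ?_ (fun x => hm _) (fun x => gridWidth_le hr _)
      (by linarith [hr.1]) (fun x p q => (dist_squareMap hr x p q).le) (by rw [hcoe]; exact hs.2.le)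
      (by norm_num) (by norm_num) (sum_smul_map_volume_le hr) (fun p δ hδ => ?_) (fun p δ hδ => ?_)
      (by rw [hcoe]; exact hsum)
    · exact lt_min hr.1 (by linarith [hr.2])
    · rw [volume_ball_square]
      calc _ = ENNReal.ofReal (δ / 2) * ENNReal.ofReal (δ / 2) := by
            rw [← ENNReal.ofReal_mul (by linarith [hδ.1]), Real.rpow_two]
            congr 1
            ring
        _ ≤ _ := mul_le_mul' (le_volume_ball_unitInterval _ hδ) (le_volume_ball_unitInterval _ hδ)
    · rw [volume_ball_square]
      calc _ ≤ ENNReal.ofReal (2 * δ) * ENNReal.ofReal (2 * δ) :=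
            mul_le_mul' (volume_ball_unitInterval_le _ _) (volume_ball_unitInterval_le _ _)
        _ = ENNReal.ofReal (4 * δ ^ (2 : ℝ)) := by
            rw [← ENNReal.ofReal_mul (by linarith), Real.rpow_two]
            congr 1
            ring

end Cells

/-! ### The invariant copulas -/

theorem mainTheorem1 (r s : ℝ) (hr : r ∈ Set.Ioo (0 : ℝ) (1 / 2)) (hs : s ∈ Set.Ioo (1 : ℝ) 2)
    (hrs : 4 * r ^ s + (1 - 2 * r) ^ s = 1) :
    MaximalConvexLineable (copulasWithSupportDim s) ∧
    ∃ (C : Set.Ioo (0 : ℝ) r → C(I × I, ℝ))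
      (μ : Set.Ioo (0 : ℝ) r → MeasureTheory.Measure (I × I)) (K : Set (I × I)),
      -- `C a` is the unique invariant copula of `T_{r,a}`, and `μ a` is its measure
      (∀ a : Set.Ioo (0 : ℝ) r, IsTransformationMatrix (transMatrix r a) ∧
        IsInvariantCopula (transMatrix r a) (C a) ∧
        (∀ D : I × I → ℝ, IsInvariantCopula (transMatrix r a) D → D = C a) ∧
        IsCopulaMeasure (C a) (μ a)) ∧
      -- the measures are pairwise mutually singular
      (∀ a b : Set.Ioo (0 : ℝ) r, a ≠ b → (μ a).MutuallySingular (μ b)) ∧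
      -- they all have the same self-similar support `K`, of Hausdorff dimension `s`
      (∀ a : Set.Ioo (0 : ℝ) r, (μ a).support = K ∧
        K = ⋃ (i : Fin 3) (j : Fin 3) (_ : transMatrix r a i j ≠ 0),
          cellMap (transMatrix r a) i j '' K) ∧
      IsCompact K ∧ K.Nonempty ∧ dimH K = ENNReal.ofReal s ∧
      -- the copulas `C a` witness that the set is maximal convex lineable
      WitnessesConvexLineable (Set.range C) (copulasWithSupportDim s) ∧
      Cardinal.mk (Set.range C) = Cardinal.mk C(I × I, ℝ) ∧
      Cardinal.mk (Set.range C) = Cardinal.continuum := by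
  have hr1 : 0 ≤ 1 - r := by linarith [hr.2]
  have hc : (⟨1 - r, hr1⟩ : ℝ≥0) < 1 := show 1 - r < 1 by linarith [hr.1]
  have hlip : ∀ x, LipschitzWith ⟨1 - r, hr1⟩ (squareMap r x) := fun x =>
    LipschitzWith.of_dist_le_mul fun p q => (dist_squareMap hr x p q).le.trans
      (mul_le_mul_of_nonneg_right (gridWidth_le hr _) dist_nonneg)
  have : Nonempty CellIndex := ⟨⟨(1, 1), Iff.rfl⟩⟩
  obtain ⟨π, hπ⟩ := exists_isCodingMap hc hlip
  have hw : ∀ a : Ioo (0 : ℝ) r, ∑ x, cellWeight r a x = 1 := fun a => sum_cellWeight a.2 hr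
  set μ : Ioo (0 : ℝ) r → Measure (I × I) := fun a => (bernoulliMeasure (cellWeight r a)).map π
  have hprob : ∀ a, IsProbabilityMeasure (μ a) := fun a => by
    have := isProbabilityMeasure_bernoulliMeasure (hw a)
    exact Measure.isProbabilityMeasure_map hπ.continuous.measurable.aemeasurable
  have hself : ∀ a, μ a = ∑ x, cellWeight r a x • (μ a).map (squareMap r x) := fun a =>
    hπ.map_bernoulliMeasure (measurable_squareMap hr) (hw a)
  have hfst : ∀ a, (μ a).map Prod.fst = volume := fun a => map_fst_eq_volume a.2 hr (hself a)
  have hsnd : ∀ a, (μ a).map Prod.snd = volume := fun a => map_snd_eq_volume a.2 hr (hself a)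
  have hcop : ∀ a, IsCopula (squareCdf (μ a)) := fun a => isCopula_squareCdf _ (hfst a) (hsnd a)
  set C : Ioo (0 : ℝ) r → C(I × I, ℝ) := fun a => ⟨squareCdf (μ a), (hcop a).continuous⟩
  have hmeas : ∀ a, IsCopulaMeasure (C a) (μ a) := fun a => isCopulaMeasure_squareCdf (μ a)
  have hinv : ∀ a : Ioo (0 : ℝ) r, IsInvariantCopula (transMatrix r a) (C a) := fun a =>
    ⟨hcop a, transformCopula_squareCdf a.2 hr (hself a)⟩
  have hsing : ∀ a b, a ≠ b → (μ a).MutuallySingular (μ b) := by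
    intro a b hab
    refine hπ.mutuallySingular_map (squareMap_injective hr) (measurableSet_gridLines r)
      (range_squareMap_inter_subset hr) (hw a) (hw b) (i := ⟨(0, 0), by decide⟩) ?_
      (measure_gridLines (hfst a) (hsnd a) r) (measure_gridLines (hfst b) (hsnd b) r)
    -- the entry `r - a` in the corner distinguishes the matrices
    have h1 := a.2.2
    have h2 := b.2.2
    simp only [cellWeight, transMatrix, Matrix.of_apply, Matrix.cons_val_zero]
    rw [Ne, ENNReal.ofReal_eq_ofReal_iff (by linarith) (by linarith)]
    exact fun h => hab (Subtype.ext (by linarith))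
  have hsupp : ∀ a, (μ a).support = range π := fun a =>
    hπ.support_map_bernoulliMeasure hc hlip ediam_square_le (hw a) fun x => by
      have h1 := (transMatrix_ne_zero_iff a.2 hr x.1.1 x.1.2).2 x.2
      have h2 := transMatrix_nonneg a.2 hr x.1.1 x.1.2
      exact (ENNReal.ofReal_pos.2 (lt_of_le_of_ne h2 h1.symm)).ne'
  have hdim : dimH (range π) = ENNReal.ofReal s := dimH_attractor hr hs hrs hπ
  have hlin : LinearIndependent ℝ C := linearIndependent_of_mutuallySingular hcop hmeas hsing
  have hcard : Cardinal.mk (range C) = Cardinal.continuum := by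
    rw [Cardinal.mk_range_eq C hlin.injective]
    exact Cardinal.mk_Ioo_real hr.1
  have hwit : WitnessesConvexLineable (range C) (copulasWithSupportDim s) := by
    refine ⟨?_, hlin.linearIndepOn_id, ?_⟩
    · rw [← Set.infinite_coe_iff, Cardinal.infinite_iff, hcard]
      exact Cardinal.aleph0_le_continuum
    · refine (convexHull_min ?_ (convex_copulas_with_support (range π))).trans ?_
      · rintro _ ⟨a, rfl⟩
        exact ⟨hcop a, μ a, hmeas a, hsupp a⟩
      · rintro D ⟨hD, ν, hν, hνK⟩
        exact ⟨hD, ν, hν, by rw [hνK, hdim]⟩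
  have hcard' : Cardinal.mk (range C) = Cardinal.mk C(I × I, ℝ) :=
    hcard.trans mk_continuousMap_square.symm
  refine ⟨⟨range C, hwit, hcard'⟩, C, μ, range π, fun a => ⟨?_, hinv a, ?_, hmeas a⟩, hsing,
    fun a => ⟨hsupp a, ?_⟩, isCompact_range hπ.continuous, range_nonempty π, hdim, hwit, hcard',
    hcard⟩
  · exact isTransformationMatrix_transMatrix a.2 hr
  · exact fun D hD => hD.eq a.2 hr (hinv a)
  · simp only [cellMap_transMatrix, transMatrix_ne_zero_iff a.2 hr]
    conv_lhs => rw [hπ.range_eq_iUnion]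
    rw [iUnion_subtype]
    ext p
    simp only [mem_iUnion, Prod.exists]
    rfl
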